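/- **Setting.** For a twice differentiable $f:\mathbb R^d\to\mathbb R$ with $\int e^{-f}=1$, let $\pi$ be the probability measure with density $e^{-f}$, and write $\mathcal H(x,v)=f(x)+\frac12\|v\|_2^2$. The (Metropolized) HMC chain with step size $\eta>0$ and $K\ge 1$ steps moves from $x$ as follows: draw $v_0\sim\mathcal N(0,\mathbf I)$, put $x_0=x$; for $0\le k<K$ set $v_{k+1/2}=v_k-\frac{\eta}{2}\nabla f(x_k)$, $x_{k+1}=x_k+\eta v_{k+1/2}$, $v_{k+1}=v_{k+1/2}-\frac{\eta}{2}\nabla f(x_{k+1})$; move to $x_K$ with probability $\min\{1,e^{\mathcal H(x_0,v_0)-\mathcal H(x_K,v_K)}\}$ and otherwise stay at $x$. Let $\mathcal T_x$ be the law of the next state. The relaxation time is $1/\lambda$ (infinite if $\lambda=0$), where $$\lambda=\inf_{g\in L^2(\pi),\ \mathrm{Var}_\pi[g]>0}\frac{\mathcal E(g,g)}{\mathrm{Var}_\pi[g]},\qquad \mathcal E(g,h)=\int g\,h\,d\pi-\iint g(y)h(x)\,\mathcal T_x(dy)\,\pi(dx).$$ **Proposition.** For all constants $C_1,C_2,C_3$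 there are $c>0$ and $d_0\in\mathbb N$ such that the following holds for all $d\ge d_0$, all $\kappa$ with $10\le\kappa\le C_3d^4$, and all $\eta>0$ and integers $K\ge1$ with $$\eta^2K\le C_1\frac{\sqrt{\log d}}{\kappa\sqrt d},\qquad K\le C_2\,d^{0.099}.$$ 1. There is a target density $e^{-f}$ on $\mathbb R^d$ whose negative log-density $f$ is $\kappa$-smooth, and more precisely satisfies $\frac{1}{\log d}\mathbf I\preceq\nabla^2f(x)\preceq\kappa\mathbf I$ for all $x$, such that the relaxation time of HMC with parameters $\eta,K$ is at least $c\,\frac{\kappa d}{K^2}$. 2. There is a target density $e^{-f}$ on $\mathbb R^d$ with $\mathbf I\preceq\nabla^2f(x)\preceq\kappa\mathbf I$ for all $x$, such that the relaxation time of HMC with parameters $\eta,K$ is at least $c\,\frac{\kappa d}{K^2\log d}$. -/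

import Mathlib

open MeasureTheory ProbabilityTheory
open scoped ENNReal

noncomputable section

namespace HMC

/-- The Euclidean space of dimension `d`. -/
abbrev Space (d : ℕ) : Type := EuclideanSpace ℝ (Fin d)

/-- `f` is twice differentiable and its Hessian satisfies `μ I ≼ ∇² f(x) ≼ L I` at every point `x`,
that is, `f` is `L`-smooth and `μ`-strongly convex (the Hessian is the derivative of the gradient;
differentiability of the gradient makes `f` twice differentiable). -/
structure HessianBetween {d : ℕ} (μ L : ℝ) (f : Space d → ℝ) : Prop where
  differentiable : Differentiable ℝ f
  differentiable_gradient : Differentiable ℝ (gradient f)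
  lower : ∀ x v : Space d, μ * ‖v‖ ^ 2 ≤ inner ℝ v (fderiv ℝ (gradient f) x v)
  upper : ∀ x v : Space d, inner ℝ v (fderiv ℝ (gradient f) x v) ≤ L * ‖v‖ ^ 2

/-- The measure on `ℝ^d` with Lebesgue density `exp (-f)`. -/
def target {d : ℕ} (f : Space d → ℝ) : Measure (Space d) :=
  volume.withDensity fun x => ENNReal.ofReal (Real.exp (-f x))

/-- One leapfrog step of size `η` for the potential `f`, from position and velocity `(x, v)`. -/
def leapfrogStep {d : ℕ} (f : Space d → ℝ) (η : ℝ) (p : Space d × Space d) :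
    Space d × Space d :=
  let vHalf := p.2 - (η / 2) • gradient f p.1
  let x' := p.1 + η • vHalf
  (x', vHalf - (η / 2) • gradient f x')

/-- `K` leapfrog steps of size `η`: the map `(x₀, v₀) ↦ (x_K, v_K)`. -/
def leapfrog {d : ℕ} (f : Space d → ℝ) (η : ℝ) (K : ℕ) : Space d × Space d → Space d × Space d :=
  (leapfrogStep f η)^[K]

/-- The Hamiltonian `H(x, v) = f(x) + ‖v‖² / 2`. -/
def hamiltonian {d : ℕ} (f : Space d → ℝ) (p : Space d × Space d) : ℝ :=
  f p.1 + ‖p.2‖ ^ 2 / 2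

/-- The Metropolis acceptance probability `min {1, exp(-H(x_K, v_K)) / exp(-H(x₀, v₀))}`
of the proposal made from `x₀ = x` with initial velocity `v₀ = v`. -/
def acceptProb {d : ℕ} (f : Space d → ℝ) (η : ℝ) (K : ℕ) (x v : Space d) : ℝ :=
  min 1 (Real.exp (-hamiltonian f (leapfrog f η K (x, v))) / Real.exp (-hamiltonian f (x, v)))

/-- The transition distribution from `x` of Metropolized HMC: draw `v ~ N(0, I)`, move to the
position `x_K` after `K` leapfrog steps with the acceptance probability, otherwise stay at `x`. -/
def transition {d : ℕ} (f : Space d → ℝ) (η : ℝ) (K : ℕ) (x : Space d) : Measure (Space d) :=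
  ((stdGaussian (Space d)).withDensity fun v => ENNReal.ofReal (acceptProb f η K x v)).map
      (fun v => (leapfrog f η K (x, v)).1)
    + (∫⁻ v, ENNReal.ofReal (1 - acceptProb f η K x v) ∂(stdGaussian (Space d))) • Measure.dirac x

/-- The Dirichlet form `∫ g h dπ - ∬ g(y) h(x) T_x(dy) π(dx)` of a Markov chain with transition
distributions `T_x` and stationary distribution `π`. -/
def dirichletForm {Ω : Type*} [MeasurableSpace Ω] (T : Ω → Measure Ω) (π : Measure Ω)
    (g h : Ω → ℝ) : ℝ :=
  (∫ x, g x * h x ∂π) - ∫ x, (∫ y, g y * h x ∂(T x)) ∂π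

/-- The spectral gap: the infimum of `E(g, g) / Var_π[g]` over all square-integrable `g` of
nonzero variance. -/
def spectralGap {Ω : Type*} [MeasurableSpace Ω] (T : Ω → Measure Ω) (π : Measure Ω) : ℝ≥0∞ :=
  ⨅ (g : Ω → ℝ) (_ : MemLp g 2 π) (_ : 0 < variance g π),
    ENNReal.ofReal (dirichletForm T π g g / variance g π)

/-- The relaxation time, the inverse of the spectral gap (infinite if the gap vanishes). -/
def relaxationTime {Ω : Type*} [MeasurableSpace Ω] (T : Ω → Measure Ω) (π : Measure Ω) : ℝ≥0∞ :=
  (spectralGap T π)⁻¹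

end HMC

end

namespace HMC

/-! The hard target depends on the step size; the threshold is `κ η² d = 1280 log d`.

Below the threshold an isotropic Gaussian with Hessian `μ I` is slow. Over `K` steps a coordinate is
multiplied by `1 + O(η² μ K²)` and receives a multiple of its initial velocity. With that coordinate
as test function, the first effect contributes at most `η² μ K² Var`. The velocity would average out
but for its correlation with acceptance. Flipping the sign of the velocity shows that this
correlation is small, and `η² μ √d ≤ 1` makes its contribution of the same order. The relaxation
time is thus at least `1 / (3 η² μ K²)`, which is of order `κ d / (K² μ log d)` in this regime
(`exists_slow_potential_of_small_step`).

Above the threshold, the Gaussian carries in each coordinate a cosine ripple of wavelength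
comparable to `η`. In units of `η` the leapfrog step has length one, the velocity remains standard
normal, and the potential is `ε * cosPotential` with `ε = κ η²`. The energy gained is the
trapezoidal error for the sine force plus a telescoping term, which is nonnegative for orbits from
the minimum. Such orbits nearly follow the free motion `k v`; there the Gaussian average suppresses
every oscillating term and leaves a mean error of at least `1/2`. Hence `exp (-ΔH)` has mean at most
`exp (-ε / 256)` per coordinate (`exists_integral_exp_neg_energy_le`), and independence of the
coordinates makes acceptance at the origin exponentially unlikely. A small neighbourhood of the
origin is then a bottleneck (`le_relaxationTime_of_integral_acceptProb_lt`). The resulting bound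
`exp (κ η² d / 256) / 4` is at least `d ^ 5 / 4`, which suffices since `κ` is at most of order `d ^
4`. -/

/-! ### The leapfrog map on the line and its energy error. -/

/-- The rescaled potential `q² / 4 - cos (4 q) / 64`. -/
noncomputable def cosPotential (q : ℝ) : ℝ := q ^ 2 / 4 - Real.cos (4 * q) / 64

/-- The derivative of `cosPotential`. -/
noncomputable def cosForce (q : ℝ) : ℝ := q / 2 + Real.sin (4 * q) / 16

/-- The leapfrog step of unit size for the potential `ε * cosPotential` on the line. -/
noncomputable def lineStep (ε : ℝ) (z : ℝ × ℝ) : ℝ × ℝ :=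
  (z.1 + (z.2 - ε / 2 * cosForce z.1),
    z.2 - ε / 2 * cosForce z.1 - ε / 2 * cosForce (z.1 + (z.2 - ε / 2 * cosForce z.1)))

/-- The energy of the potential `ε * cosPotential` on the line. -/
noncomputable def lineEnergy (ε : ℝ) (z : ℝ × ℝ) : ℝ := ε * cosPotential z.1 + z.2 ^ 2 / 2

/-- The error of the trapezoidal rule for the integral of the sine over `[s, t]`. -/
noncomputable def trapError (s t : ℝ) : ℝ :=
  Real.cos s - Real.cos t - (Real.sin s + Real.sin t) / 2 * (t - s)

lemma abs_cosForce_le (q : ℝ) : |cosForce q| ≤ 3 / 4 * |q| := by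
  have h : |Real.sin (4 * q)| ≤ |4 * q| := Real.abs_sin_le_abs
  rw [abs_mul, abs_of_pos (by norm_num : (0:ℝ) < 4)] at h
  calc |cosForce q| ≤ |q / 2| + |Real.sin (4 * q) / 16| := abs_add_le _ _
    _ = |q| / 2 + |Real.sin (4 * q)| / 16 := by
      rw [abs_div, abs_div, abs_of_pos (by norm_num : (0:ℝ) < 2),
        abs_of_pos (by norm_num : (0:ℝ) < 16)]
    _ ≤ _ := by linarith

lemma cosForce_zero : cosForce 0 = 0 := by simp [cosForce]

lemma hasDerivAt_cosPotential (q : ℝ) : HasDerivAt cosPotential (cosForce q) q := by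
  have h1 : HasDerivAt (fun q : ℝ => 4 * q) 4 q := by simpa using (hasDerivAt_id q).const_mul 4
  refine (((hasDerivAt_pow 2 q).div_const 4).sub (h1.cos.div_const 64)).congr_deriv ?_
  rw [cosForce]; push_cast; ring

lemma hasDerivAt_cosForce (q : ℝ) :
    HasDerivAt cosForce (1 / 2 + Real.cos (4 * q) / 4) q := by
  have h1 : HasDerivAt (fun q : ℝ => 4 * q) 4 q := by simpa using (hasDerivAt_id q).const_mul 4
  refine (((hasDerivAt_id q).div_const 2).add (h1.sin.div_const 16)).congr_deriv ?_
  ring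

lemma continuous_cosForce : Continuous cosForce := by unfold cosForce; fun_prop

lemma continuous_cosPotential : Continuous cosPotential := by unfold cosPotential; fun_prop

lemma continuous_lineStep (ε : ℝ) : Continuous (lineStep ε) := by
  have := continuous_cosForce
  unfold lineStep; fun_prop

/-- Leapfrog changes the energy by the trapezoidal error of the force plus a difference of squared
forces. The trapezoidal rule is exact on the linear part of the force, so only the sine is left. -/
lemma lineEnergy_lineStep_sub (ε : ℝ) (z : ℝ × ℝ) :
    lineEnergy ε (lineStep ε z) - lineEnergy ε z =
      ε / 64 * trapError (4 * z.1) (4 * (lineStep ε z).1)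
        + ε ^ 2 / 8 * (cosForce (lineStep ε z).1 ^ 2 - cosForce z.1 ^ 2) := by
  obtain ⟨q, v⟩ := z
  simp only [lineEnergy, lineStep, trapError]
  set F := cosForce q with hF
  set q' := q + (v - ε / 2 * F) with hq'
  set F' := cosForce q' with hF'
  have hv : v = q' - q + ε / 2 * F := by rw [hq']; ring
  have e1 : Real.sin (4 * q) = 16 * (F - q / 2) := by rw [hF, cosForce]; ring
  have e2 : Real.sin (4 * q') = 16 * (F' - q' / 2) := by rw [hF', cosForce]; ring
  rw [e1, e2, cosPotential, cosPotential]
  clear_value F q' F'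
  subst hv
  ring

lemma lineEnergy_iterate_sub (ε : ℝ) (z : ℝ × ℝ) (K : ℕ) :
    lineEnergy ε ((lineStep ε)^[K] z) - lineEnergy ε z =
      ε / 64 * ∑ k ∈ Finset.range K,
          trapError (4 * ((lineStep ε)^[k] z).1) (4 * ((lineStep ε)^[k + 1] z).1)
        + ε ^ 2 / 8 * (cosForce ((lineStep ε)^[K] z).1 ^ 2 - cosForce z.1 ^ 2) := by
  induction K with
  | zero => simp
  | succ K ih =>
    have h := lineEnergy_lineStep_sub ε ((lineStep ε)^[K] z)
    rw [← Function.iterate_succ_apply' (lineStep ε)] at h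
    rw [Finset.sum_range_succ]
    linear_combination h + ih

lemma abs_trapError_le (s t : ℝ) : |trapError s t| ≤ 2 + |t - s| := by
  have h1 := abs_le.1 (Real.abs_cos_le_one s)
  have h2 := abs_le.1 (Real.abs_cos_le_one t)
  have h3 : |(Real.sin s + Real.sin t) / 2| ≤ 1 := by
    have h1 := abs_le.1 (Real.abs_sin_le_one s)
    have h2 := abs_le.1 (Real.abs_sin_le_one t)
    rw [abs_le]; constructor <;> linarith
  have h4 : |(Real.sin s + Real.sin t) / 2 * (t - s)| ≤ |t - s| := by
    rw [abs_mul]; exact mul_le_of_le_one_left (abs_nonneg _) h3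
  have h5 := abs_le.1 h4
  unfold trapError
  rw [abs_le]; constructor <;> linarith

/-- Only the length of the second interval enters; for the free motion it is `4 |v|` at every step.
-/
lemma abs_trapError_sub_le (s t s' t' : ℝ) :
    |trapError s t - trapError s' t'| ≤ (|s - s'| + |t - t'|) * (2 + |t' - s'| / 2) := by
  have c1 : |Real.cos s - Real.cos s'| ≤ |s - s'| := Real.abs_cos_sub_cos_le s s'
  have c2 : |Real.cos t - Real.cos t'| ≤ |t - t'| := Real.abs_cos_sub_cos_le t t'
  have s1 : |Real.sin s - Real.sin s'| ≤ |s - s'| := Real.abs_sin_sub_sin_le s s'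
  have s2 : |Real.sin t - Real.sin t'| ≤ |t - t'| := Real.abs_sin_sub_sin_le t t'
  have h3 : |(Real.sin s + Real.sin t) / 2| ≤ 1 := by
    have h1 := abs_le.1 (Real.abs_sin_le_one s)
    have h2 := abs_le.1 (Real.abs_sin_le_one t)
    rw [abs_le]; constructor <;> linarith
  have e : trapError s t - trapError s' t' =
      (Real.cos s - Real.cos s') - (Real.cos t - Real.cos t')
      - (Real.sin s + Real.sin t) / 2 * ((t - t') - (s - s'))
      - ((Real.sin s - Real.sin s') + (Real.sin t - Real.sin t')) / 2 * (t' - s') := by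
    unfold trapError; ring
  have b1 : |(Real.sin s + Real.sin t) / 2 * ((t - t') - (s - s'))| ≤ |t - t'| + |s - s'| := by
    rw [abs_mul]
    exact (mul_le_of_le_one_left (abs_nonneg _) h3).trans (abs_sub _ _)
  have b2 : |((Real.sin s - Real.sin s') + (Real.sin t - Real.sin t')) / 2 * (t' - s')| ≤
      (|s - s'| + |t - t'|) / 2 * |t' - s'| := by
    rw [abs_mul, abs_div, abs_of_pos (by norm_num : (0:ℝ) < 2)]
    gcongr
    exact (abs_add_le _ _).trans (add_le_add s1 s2)
  rw [e]
  have t1 := abs_le.1 c1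
  have t2 := abs_le.1 c2
  have t3 := abs_le.1 b1
  have t4 := abs_le.1 b2
  rw [abs_le]; constructor <;> linarith

/-- The leapfrog orbit of `(0, v)` stays close to the free motion. -/
lemma abs_lineStep_iterate_sub_le {ε : ℝ} (hε : 0 ≤ ε) (v : ℝ) (k : ℕ)
    (hk : ε * (k : ℝ) ^ 2 ≤ 1) :
    |((lineStep ε)^[k] (0, v)).1 - k * v| ≤ ε * (k : ℝ) ^ 3 * |v| ∧
      |((lineStep ε)^[k] (0, v)).2 - v| ≤ ε * (k : ℝ) ^ 2 * |v| := by
  induction k with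
  | zero => simp
  | succ k ih =>
    have hk0 : (0 : ℝ) ≤ k := k.cast_nonneg
    have hv0 := abs_nonneg v
    push_cast at hk ⊢
    have hk' : ε * (k : ℝ) ^ 2 ≤ 1 := le_trans (by gcongr; linarith) hk
    obtain ⟨h1, h2⟩ := ih hk'
    rw [Function.iterate_succ_apply']
    set q := ((lineStep ε)^[k] (0, v)).1
    set u := ((lineStep ε)^[k] (0, v)).2
    have hz : (lineStep ε)^[k] (0, v) = (q, u) := rfl
    rw [hz]
    simp only [lineStep]
    set q' := q + (u - ε / 2 * cosForce q)
    have hq : |q| ≤ 2 * k * |v| := by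
      have : |q| ≤ |q - k * v| + |(k : ℝ) * v| := by simpa using abs_add_le (q - k * v) (k * v)
      rw [abs_mul, abs_of_nonneg hk0] at this
      have h3 : ε * (k : ℝ) ^ 3 * |v| = (ε * (k : ℝ) ^ 2) * (k * |v|) := by ring
      have h4 : (ε * (k : ℝ) ^ 2) * (k * |v|) ≤ k * |v| :=
        mul_le_of_le_one_left (by positivity) hk'
      linarith
    have hF : |cosForce q| ≤ 3 / 2 * k * |v| := (abs_cosForce_le q).trans (by linarith)
    have hεF : |ε / 2 * cosForce q| ≤ 3 / 4 * (ε * k * |v|) := by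
      rw [abs_mul, abs_of_nonneg (by positivity : 0 ≤ ε / 2)]
      calc ε / 2 * |cosForce q| ≤ ε / 2 * (3 / 2 * k * |v|) := by gcongr
        _ = _ := by ring
    have hεv : 0 ≤ ε * |v| := by positivity
    have h1' : |q' - (k + 1) * v| ≤ ε * ((k : ℝ) + 1) ^ 3 * |v| := by
      have e : q' - (k + 1) * v = (q - k * v) + (u - v) - ε / 2 * cosForce q := by
        simp only [q']; ring
      rw [e]
      have := (abs_sub ((q - k * v) + (u - v)) (ε / 2 * cosForce q)).trans
        (add_le_add_left (abs_add_le _ _) _)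
      -- The first three terms are the errors from position, velocity and force; the last is
      -- nonnegative slack.
      have e2 : ε * ((k : ℝ) + 1) ^ 3 * |v| = ε * (k : ℝ) ^ 3 * |v| + ε * (k : ℝ) ^ 2 * |v|
          + 3 / 4 * (ε * k * |v|) + (ε * |v|) * (2 * (k : ℝ) ^ 2 + 9 / 4 * k + 1) := by ring
      have : 0 ≤ (ε * |v|) * (2 * (k : ℝ) ^ 2 + 9 / 4 * k + 1) := by positivity
      linarith
    refine ⟨h1', ?_⟩
    have hq' : |q'| ≤ 2 * (k + 1) * |v| := by
      have : |q'| ≤ |q' - (k + 1) * v| + |((k : ℝ) + 1) * v| := by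
        simpa using abs_add_le (q' - (k + 1) * v) ((k + 1) * v)
      rw [abs_mul, abs_of_nonneg (by positivity : (0:ℝ) ≤ k + 1)] at this
      have h3 : ε * ((k : ℝ) + 1) ^ 3 * |v| = (ε * ((k : ℝ) + 1) ^ 2) * ((k + 1) * |v|) := by ring
      have h4 : (ε * ((k : ℝ) + 1) ^ 2) * ((k + 1) * |v|) ≤ (k + 1) * |v| :=
        mul_le_of_le_one_left (by positivity) hk
      linarith
    have hεF' : |ε / 2 * cosForce q'| ≤ 3 / 4 * (ε * (k + 1) * |v|) := by
      rw [abs_mul, abs_of_nonneg (by positivity : 0 ≤ ε / 2)]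
      calc ε / 2 * |cosForce q'| ≤ ε / 2 * (3 / 4 * (2 * (k + 1) * |v|)) := by
            gcongr; exact (abs_cosForce_le q').trans (by gcongr)
        _ = _ := by ring
    have e : u - ε / 2 * cosForce q - ε / 2 * cosForce q' - v =
        (u - v) - ε / 2 * cosForce q - ε / 2 * cosForce q' := by ring
    rw [e]
    have b := (abs_sub ((u - v) - ε / 2 * cosForce q) (ε / 2 * cosForce q')).trans
        (add_le_add_left (abs_sub _ _) _)
    have e2 : ε * ((k : ℝ) + 1) ^ 2 * |v| = ε * (k : ℝ) ^ 2 * |v| + 3 / 4 * (ε * k * |v|)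
      + 3 / 4 * (ε * (k + 1) * |v|) + (ε * |v|) * (1 / 2 * k + 1 / 4) := by ring
    have : 0 ≤ (ε * |v|) * (1 / 2 * k + 1 / 4) := by positivity
    linarith

/-! ### Gaussian averages of trigonometric functions. -/

lemma charFun_gaussianReal_zero_one :
    charFun (gaussianReal 0 1) = fun t : ℝ => ((Real.exp (-(t ^ 2 / 2)) : ℝ) : ℂ) := by
  ext t
  rw [charFun_gaussianReal]
  push_cast
  congr 1
  simp

lemma integrable_cexp_mul_I_gaussian (t : ℝ) :
    Integrable (fun x : ℝ => Complex.exp (t * x * Complex.I)) (gaussianReal 0 1) := by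
  refine Integrable.of_bound (C := 1) (Continuous.aestronglyMeasurable (by fun_prop))
    (Filter.Eventually.of_forall fun x => ?_)
  rw [← Complex.ofReal_mul, Complex.norm_exp_ofReal_mul_I]

lemma integral_cos_mul_gaussian (t : ℝ) :
    ∫ x, Real.cos (t * x) ∂(gaussianReal 0 1) = Real.exp (-(t ^ 2 / 2)) := by
  have h := congrArg Complex.re (congrFun charFun_gaussianReal_zero_one t)
  rw [charFun_apply_real, Complex.ofReal_re] at h
  rw [← h]
  refine Eq.trans ?_ (integral_re (𝕜 := ℂ) (integrable_cexp_mul_I_gaussian t))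
  congr 1 with x
  simp only [RCLike.re_to_complex]
  rw [← Complex.ofReal_mul, Complex.exp_ofReal_mul_I_re]

/-- This is the derivative in `t` of the characteristic function, taken under the integral sign. -/
lemma integral_mul_sin_mul_gaussian (t : ℝ) :
    ∫ x, x * Real.sin (t * x) ∂(gaussianReal 0 1) = t * Real.exp (-(t ^ 2 / 2)) := by
  have h := iteratedDeriv_charFun (n := 1) (μ := gaussianReal 0 1) (t := t)
    (memLp_id_gaussianReal' _ (by simp))
  rw [iteratedDeriv_one, charFun_gaussianReal_zero_one] at h
  have hd : HasDerivAt (fun t : ℝ => Real.exp (-(t ^ 2 / 2)))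
      (Real.exp (-(t ^ 2 / 2)) * (-t)) t := by
    have h0 : HasDerivAt (fun t : ℝ => -(t ^ 2 / 2)) (-t) t :=
      (((hasDerivAt_pow 2 t).div_const 2).neg).congr_deriv (by push_cast; ring)
    exact h0.exp
  rw [hd.ofReal_comp.deriv] at h
  have h2 := congrArg Complex.re h
  have hint : Integrable (fun x : ℝ => (x : ℂ) ^ 1 * Complex.exp (t * x * Complex.I))
      (gaussianReal 0 1) := by
    refine Integrable.mono' (g := fun x => |x|)
      ((memLp_id_gaussianReal (μ := 0) (v := 1) 1).integrable le_rfl).abs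
      (Continuous.aestronglyMeasurable (by fun_prop)) (Filter.Eventually.of_forall fun x => ?_)
    rw [norm_mul, ← Complex.ofReal_mul, Complex.norm_exp_ofReal_mul_I]
    simp
  rw [Complex.ofReal_re, pow_one, Complex.I_mul_re] at h2
  have h3 : ∫ x, x * Real.sin (t * x) ∂(gaussianReal 0 1) =
      (∫ x : ℝ, (x : ℂ) ^ 1 * Complex.exp (t * x * Complex.I) ∂(gaussianReal 0 1)).im := by
    refine Eq.trans ?_ (integral_im (𝕜 := ℂ) hint)
    congr 1 with x
    simp only [RCLike.im_to_complex, pow_one]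
    rw [← Complex.ofReal_mul, Complex.im_ofReal_mul, Complex.exp_ofReal_mul_I_im]
  rw [h3]
  linarith

lemma integral_sq_gaussian : ∫ x, x ^ 2 ∂(gaussianReal 0 1) = 1 := by
  have h := variance_id_gaussianReal (μ := 0) (v := 1)
  rw [variance_eq_integral (by fun_prop)] at h
  simpa using h

lemma integrable_sq_gaussian : Integrable (fun x : ℝ => x ^ 2) (gaussianReal 0 1) :=
  (memLp_id_gaussianReal (μ := 0) (v := 1) 2).integrable_sq

lemma exp_neg_le (t : ℝ) : Real.exp (-t) ≤ 1 - t + t ^ 2 * Real.exp |t| := by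
  have h := Complex.norm_exp_sub_sum_le_norm_mul_exp ((-t : ℝ) : ℂ) 2
  have e : Complex.exp ((-t : ℝ) : ℂ) - ∑ m ∈ Finset.range 2, ((-t : ℝ) : ℂ) ^ m / (m.factorial : ℂ)
      = ((Real.exp (-t) - (1 - t) : ℝ) : ℂ) := by
    simp [Finset.sum_range_succ]; ring
  rw [e, Complex.norm_real, Complex.norm_real, Real.norm_eq_abs, Real.norm_eq_abs, abs_neg,
    sq_abs] at h
  have := (abs_le.1 h).2
  linarith

/-! ### Mean energy gain of an orbit started at the minimum. -/

/-- The accumulated trapezoidal errors along the orbit of `(0, v)`. -/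
noncomputable def orbitError (ε : ℝ) (K : ℕ) (v : ℝ) : ℝ :=
  ∑ k ∈ Finset.range K,
    trapError (4 * ((lineStep ε)^[k] (0, v)).1) (4 * ((lineStep ε)^[k + 1] (0, v)).1)

/-- The accumulated trapezoidal errors along the free motion. -/
noncomputable def freeError (K : ℕ) (v : ℝ) : ℝ :=
  ∑ k ∈ Finset.range K, trapError (4 * (k * v)) (4 * ((k + 1 : ℕ) * v))

lemma continuous_lineStep_iterate (ε : ℝ) (k : ℕ) :
    Continuous fun v : ℝ => (lineStep ε)^[k] (0, v) :=
  ((continuous_lineStep ε).iterate k).comp (Continuous.prodMk continuous_const continuous_id)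

lemma continuous_trapError {f g : ℝ → ℝ} (hf : Continuous f) (hg : Continuous g) :
    Continuous fun v => trapError (f v) (g v) := by
  unfold trapError; fun_prop

lemma continuous_orbitError (ε : ℝ) (K : ℕ) : Continuous (orbitError ε K) := by
  refine continuous_finsetSum _ fun k _ => continuous_trapError ?_ ?_
  · exact continuous_const.mul (continuous_fst.comp (continuous_lineStep_iterate ε k))
  · exact continuous_const.mul (continuous_fst.comp (continuous_lineStep_iterate ε (k + 1)))

/-- Each of the `K` terms is perturbed by the position error, of order `ε K³ |v|`, times a Lipschitz
factor of order `1 + |v|`. -/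
lemma abs_orbitError_sub_freeError_le {ε : ℝ} (hε : 0 ≤ ε) (v : ℝ) (K : ℕ)
    (hK : ε * (K : ℝ) ^ 2 ≤ 1) :
    |orbitError ε K v - freeError K v| ≤ 16 * (ε * (K : ℝ) ^ 4) * (1 + 2 * v ^ 2) := by
  rw [orbitError, freeError, ← Finset.sum_sub_distrib]
  refine (Finset.abs_sum_le_sum_abs _ _).trans ?_
  have hv : |v| * (1 + |v|) ≤ 1 + 2 * v ^ 2 := by
    nlinarith [sq_abs v, sq_nonneg (|v| - 1), sq_nonneg v]
  have key : ∀ k ∈ Finset.range K,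
      |trapError (4 * ((lineStep ε)^[k] (0, v)).1) (4 * ((lineStep ε)^[k + 1] (0, v)).1) -
        trapError (4 * (k * v)) (4 * ((k + 1 : ℕ) * v))| ≤
        16 * (ε * (K : ℝ) ^ 3) * (1 + 2 * v ^ 2) := by
    intro k hk
    have hb (j : ℕ) (hj : j ≤ K) :
        |4 * ((lineStep ε)^[j] (0, v)).1 - 4 * (j * v)| ≤ 4 * (ε * (K : ℝ) ^ 3 * |v|) := by
      have hj' : (j : ℝ) ≤ K := by exact_mod_cast hj
      rw [← mul_sub, abs_mul, abs_of_pos (by norm_num : (0:ℝ) < 4)]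
      have := (abs_lineStep_iterate_sub_le hε v j (le_trans (by gcongr) hK)).1
      refine mul_le_mul_of_nonneg_left (this.trans (by gcongr)) (by norm_num)
    have hkK := Finset.mem_range.1 hk
    refine (abs_trapError_sub_le _ _ _ _).trans ?_
    have e : 4 * (((k + 1 : ℕ) : ℝ) * v) - 4 * (k * v) = 4 * v := by push_cast; ring
    rw [e, abs_mul 4 v, abs_of_pos (by norm_num : (0:ℝ) < 4)]
    calc _ ≤ (4 * (ε * (K : ℝ) ^ 3 * |v|) + 4 * (ε * (K : ℝ) ^ 3 * |v|)) * (2 + 4 * |v| / 2) := by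
          gcongr
          · exact hb k hkK.le
          · exact hb (k + 1) hkK
      _ = 16 * (ε * (K : ℝ) ^ 3) * (|v| * (1 + |v|)) := by ring
      _ ≤ _ := by gcongr
  refine (Finset.sum_le_sum key).trans ?_
  rw [Finset.sum_const, Finset.card_range, nsmul_eq_mul]
  apply le_of_eq; ring

/-- Linear growth in `v`, unlike the quadratic bound for the comparison with free motion, keeps the
exponential remainder of the energy error integrable, uniformly in `ε` and `K`. -/
lemma abs_orbitError_le {ε : ℝ} (hε : 0 ≤ ε) (v : ℝ) (K : ℕ) (hK : ε * (K : ℝ) ^ 2 ≤ 1) :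
    |orbitError ε K v| ≤ K * (2 + 12 * |v|) := by
  rw [orbitError]
  refine (Finset.abs_sum_le_sum_abs _ _).trans ?_
  have key : ∀ k ∈ Finset.range K,
      |trapError (4 * ((lineStep ε)^[k] (0, v)).1) (4 * ((lineStep ε)^[k + 1] (0, v)).1)| ≤
        2 + 12 * |v| := by
    intro k hk
    have hkK := Finset.mem_range.1 hk
    have hk0 : (0 : ℝ) ≤ k := k.cast_nonneg
    have hk1 : (k : ℝ) ≤ k ^ 2 := by
      have : k ≤ k ^ 2 := Nat.le_self_pow two_ne_zero k
      exact_mod_cast this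
    have hkK' : (k : ℝ) ≤ K := by exact_mod_cast hkK.le
    have hεk : ε * (k : ℝ) ^ 2 ≤ 1 := le_trans (by gcongr) hK
    have hεk1 : ε * (k : ℝ) ≤ 1 := le_trans (by gcongr) hεk
    obtain ⟨h1, h2⟩ := abs_lineStep_iterate_sub_le hε v k hεk
    refine (abs_trapError_le _ _).trans ?_
    rw [Function.iterate_succ_apply']
    set q := ((lineStep ε)^[k] (0, v)).1 with hq
    set u := ((lineStep ε)^[k] (0, v)).2 with hu
    have e : 4 * (lineStep ε ((lineStep ε)^[k] (0, v))).1 - 4 * q =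
        4 * (v + (u - v) - ε / 2 * cosForce q) := by
      simp only [lineStep, ← hq, ← hu]; ring
    rw [e, abs_mul, abs_of_pos (by norm_num : (0:ℝ) < 4)]
    have b1 : ε * (k : ℝ) ^ 2 * |v| ≤ |v| := mul_le_of_le_one_left (abs_nonneg _) hεk
    have hF : |ε / 2 * cosForce q| ≤ |v| := by
      rw [abs_mul, abs_of_nonneg (by positivity : 0 ≤ ε / 2)]
      have hq2 : |q| ≤ 2 * (k * |v|) := by
        have : |q| ≤ |q - k * v| + |(k : ℝ) * v| := by simpa using abs_add_le (q - k * v) (k * v)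
        rw [abs_mul, abs_of_nonneg hk0] at this
        have h3 : ε * (k : ℝ) ^ 3 * |v| = (ε * (k : ℝ) ^ 2) * (k * |v|) := by ring
        have h4 : (ε * (k : ℝ) ^ 2) * (k * |v|) ≤ k * |v| :=
          mul_le_of_le_one_left (by positivity) hεk
        linarith
      calc ε / 2 * |cosForce q| ≤ ε / 2 * (3 / 4 * (2 * (k * |v|))) := by
            gcongr; exact (abs_cosForce_le q).trans (by gcongr)
        _ = 3 / 4 * ((ε * k) * |v|) := by ring
        _ ≤ 3 / 4 * (1 * |v|) := by gcongr
        _ ≤ |v| := by linarith [abs_nonneg v]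
    have := (abs_sub (v + (u - v)) (ε / 2 * cosForce q)).trans
        (add_le_add_left (abs_add_le v (u - v)) _)
    linarith
  refine (Finset.sum_le_sum key).trans ?_
  rw [Finset.sum_const, Finset.card_range, nsmul_eq_mul]

/-- The cosines telescope. The constant `1` comes from the start at the origin and is the only term
that survives averaging over `v`. -/
lemma freeError_eq (K : ℕ) (v : ℝ) :
    freeError K v = 1 - Real.cos (4 * K * v) -
      ∑ k ∈ Finset.range K, 2 * (v * Real.sin (4 * k * v) + v * Real.sin (4 * (k + 1 : ℕ) * v)) := by
  unfold freeError trapError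
  induction K with
  | zero => simp
  | succ K ih =>
    rw [Finset.sum_range_succ, Finset.sum_range_succ, ih]
    simp only [← mul_assoc]
    push_cast
    ring

lemma integrable_mul_sin_gaussian (t : ℝ) :
    Integrable (fun x : ℝ => x * Real.sin (t * x)) (gaussianReal 0 1) := by
  refine Integrable.mono' (g := fun x => |x|)
    ((memLp_id_gaussianReal (μ := 0) (v := 1) 1).integrable le_rfl).abs
    (Continuous.aestronglyMeasurable (by fun_prop)) (Filter.Eventually.of_forall fun x => ?_)
  rw [norm_mul]
  exact mul_le_of_le_one_right (norm_nonneg _) (Real.abs_sin_le_one _)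

lemma integrable_cos_gaussian (t : ℝ) :
    Integrable (fun x : ℝ => Real.cos (t * x)) (gaussianReal 0 1) := by
  refine Integrable.of_bound (C := 1) (Continuous.aestronglyMeasurable (by fun_prop))
    (Filter.Eventually.of_forall fun x => Real.abs_cos_le_one _)

lemma integrable_freeError (K : ℕ) : Integrable (freeError K) (gaussianReal 0 1) := by
  have : freeError K = _ := funext (freeError_eq K)
  rw [this]
  exact ((integrable_const _).sub (integrable_cos_gaussian _)).sub (integrable_finsetSum _ fun k _ =>
    ((integrable_mul_sin_gaussian _).add (integrable_mul_sin_gaussian _)).const_mul _)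

lemma integral_freeError (K : ℕ) :
    ∫ v, freeError K v ∂(gaussianReal 0 1) = 1 - Real.exp (-((4 * K) ^ 2 / 2)) -
      ∑ k ∈ Finset.range K, 2 * (4 * k * Real.exp (-((4 * k) ^ 2 / 2)) +
        4 * (k + 1 : ℕ) * Real.exp (-((4 * (k + 1 : ℕ)) ^ 2 / 2))) := by
  simp_rw [freeError_eq]
  rw [integral_sub, integral_sub, integral_finsetSum]
  · simp_rw [integral_const_mul]
    congr 1
    · rw [integral_cos_mul_gaussian]; simp
    · refine Finset.sum_congr rfl fun k _ => ?_
      rw [integral_add (integrable_mul_sin_gaussian _) (integrable_mul_sin_gaussian _),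
        integral_mul_sin_mul_gaussian, integral_mul_sin_mul_gaussian]
  · exact fun k _ =>
      ((integrable_mul_sin_gaussian _).add (integrable_mul_sin_gaussian _)).const_mul _
  · exact integrable_const _
  · exact integrable_cos_gaussian _
  · exact (integrable_const _).sub (integrable_cos_gaussian _)
  · exact integrable_finsetSum _ fun k _ =>
      ((integrable_mul_sin_gaussian _).add (integrable_mul_sin_gaussian _)).const_mul _

lemma mul_exp_neg_sq_le (k : ℕ) :
    4 * (k : ℝ) * Real.exp (-((4 * k) ^ 2 / 2)) ≤ (1 / 32) * (1 / 2) ^ k := by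
  rcases Nat.eq_zero_or_pos k with rfl | hk
  · norm_num
  have hk1 : (1 : ℝ) ≤ k := by exact_mod_cast hk
  have h8 : Real.exp (-((4 * k) ^ 2 / 2)) ≤ Real.exp (-1) ^ (8 * k) := by
    rw [← Real.exp_nat_mul]
    apply Real.exp_le_exp.2
    push_cast; nlinarith
  have he : Real.exp (-1) ≤ 3 / 8 := by linarith [Real.exp_neg_one_lt_d9]
  have hk2 : (k : ℝ) ≤ 2 ^ k := by exact_mod_cast (Nat.lt_two_pow_self (n := k)).le
  calc 4 * (k : ℝ) * Real.exp (-((4 * k) ^ 2 / 2)) ≤ 4 * 2 ^ k * ((3 / 8) ^ 8) ^ k := by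
        rw [← pow_mul]; gcongr; exact h8.trans (by gcongr)
    _ = 4 * (2 * (3 / 8) ^ 8) ^ k := by rw [mul_pow]; ring
    _ ≤ 4 * ((1 / 128) * (1 / 2)) ^ k := by
        gcongr 4 * ?_
        exact pow_le_pow_left₀ (by norm_num) (by norm_num) k
    _ = 4 * (1 / 128) ^ k * (1 / 2) ^ k := by rw [mul_pow]; ring
    _ ≤ 4 * (1 / 128) ^ 1 * (1 / 2) ^ k := by
        gcongr 4 * ?_ * _
        exact pow_le_pow_of_le_one (by norm_num) (by norm_num) hk
    _ = _ := by ring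

/-- Frequency `4` is high enough that the Gaussian factors `exp (-8 k²)` make all the other terms
together smaller than `1/2`, for every number of steps. -/
lemma half_le_integral_freeError {K : ℕ} (hK : 1 ≤ K) :
    1 / 2 ≤ ∫ v, freeError K v ∂(gaussianReal 0 1) := by
  rw [integral_freeError]
  have h1 : Real.exp (-((4 * (K : ℝ)) ^ 2 / 2)) ≤ 1 / 64 := by
    have h := mul_exp_neg_sq_le K
    have hK1 : (1 : ℝ) ≤ K := by exact_mod_cast hK
    have hp : (1 / 2 : ℝ) ^ K ≤ 1 := pow_le_one₀ (by norm_num) (by norm_num)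
    have := Real.exp_pos (-((4 * (K : ℝ)) ^ 2 / 2))
    nlinarith
  have h2 : ∑ k ∈ Finset.range K, 2 * (4 * (k : ℝ) * Real.exp (-((4 * k) ^ 2 / 2)) +
        4 * (k + 1 : ℕ) * Real.exp (-((4 * (k + 1 : ℕ)) ^ 2 / 2))) ≤
      ∑ k ∈ Finset.range K, (1 / 8) * (1 / 2 : ℝ) ^ k := by
    refine Finset.sum_le_sum fun k _ => ?_
    have a := mul_exp_neg_sq_le k
    have b := mul_exp_neg_sq_le (k + 1)
    rw [pow_succ (1 / 2 : ℝ)] at b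
    have : (0 : ℝ) ≤ (1 / 2) ^ k := by positivity
    linarith
  have h3 : ∑ k ∈ Finset.range K, (1 / 8) * (1 / 2 : ℝ) ^ k ≤ 1 / 4 := by
    rw [← Finset.mul_sum]
    have := sum_geometric_two_le K
    linarith
  linarith

lemma integrable_exp_abs_gaussian :
    Integrable (fun v : ℝ => (2 + 12 * |v|) ^ 2 * Real.exp (1 + |v|)) (gaussianReal 0 1) := by
  have h : ∀ c : ℝ, Integrable (fun v : ℝ => Real.exp (c * |v|)) (gaussianReal 0 1) := fun c =>
    integrable_exp_mul_abs (X := id) (integrable_exp_mul_gaussianReal c)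
      (integrable_exp_mul_gaussianReal (-c))
  refine Integrable.mono' ((h 2).const_mul (4 * 24 ^ 2 * Real.exp 1))
    (Continuous.aestronglyMeasurable (by fun_prop)) (Filter.Eventually.of_forall fun v => ?_)
  rw [Real.norm_of_nonneg (by positivity), Real.exp_add]
  have h1 : (2 + 12 * |v|) ^ 2 ≤ 4 * 24 ^ 2 * Real.exp |v| := by
    have h2 : 1 + |v| / 2 ≤ Real.exp (|v| / 2) := by linarith [Real.add_one_le_exp (|v| / 2)]
    have h3 : Real.exp |v| = Real.exp (|v| / 2) ^ 2 := by rw [← Real.exp_nat_mul]; congr 1; ring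
    rw [h3]
    have := abs_nonneg v
    calc (2 + 12 * |v|) ^ 2 ≤ (48 * Real.exp (|v| / 2)) ^ 2 := by gcongr; linarith
      _ = _ := by ring
  calc (2 + 12 * |v|) ^ 2 * (Real.exp 1 * Real.exp |v|)
      ≤ (4 * 24 ^ 2 * Real.exp |v|) * (Real.exp 1 * Real.exp |v|) := by gcongr
    _ = 4 * 24 ^ 2 * Real.exp 1 * (Real.exp |v| * Real.exp |v|) := by ring
    _ = _ := by rw [← Real.exp_add]; congr 2; ring

/-- Started at the minimum of the potential, the leapfrog orbit gains energy on average. -/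
lemma exists_integral_exp_neg_energy_le : ∃ δ : ℝ, 0 < δ ∧ ∀ (ε : ℝ) (K : ℕ), 0 < ε → 1 ≤ K →
    ε * (K : ℝ) ^ 4 ≤ δ →
    Integrable (fun v => Real.exp (-(lineEnergy ε ((lineStep ε)^[K] (0, v)) - lineEnergy ε (0, v))))
      (gaussianReal 0 1) ∧
    ∫ v, Real.exp (-(lineEnergy ε ((lineStep ε)^[K] (0, v)) - lineEnergy ε (0, v)))
      ∂(gaussianReal 0 1) ≤ Real.exp (-(ε / 256)) := by
  set M := ∫ v, (2 + 12 * |v|) ^ 2 * Real.exp (1 + |v|) ∂(gaussianReal 0 1) with hM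
  have hM0 : 0 ≤ M := integral_nonneg fun v => by positivity
  have hMpos : 0 < 1 + 192 + 256 * M := by positivity
  -- The linear gain `ε / 128` must absorb `(48 / 64) ε (ε K⁴)` from the deviation from free motion
  -- and `ε (ε K⁴) M` from the second order, and leave `ε / 256`; times 256 these are `192` and `256
  -- M`. The summand `1` secures `ε K⁴ ≤ 1`.
  refine ⟨1 / (1 + 192 + 256 * M), by positivity, fun ε K hε hK hεK => ?_⟩
  have hK1 : (1 : ℝ) ≤ K := by exact_mod_cast hK
  rw [le_div_iff₀ hMpos] at hεK
  have hε4 : ε * (K : ℝ) ^ 4 ≤ 1 := by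
    have : 0 ≤ ε * (K : ℝ) ^ 4 := by positivity
    nlinarith
  have hε2 : ε * (K : ℝ) ^ 2 ≤ 1 :=
    le_trans (by gcongr; norm_num) hε4
  have hε1 : ε * (K : ℝ) ≤ 1 := by
    refine le_trans ?_ hε4
    gcongr
    exact le_self_pow₀ hK1 (by norm_num)
  set W := orbitError ε K with hW
  have hWi : Integrable W (gaussianReal 0 1) := by
    refine Integrable.mono' (g := fun v => K * (2 + 12 * |v|))
      (((integrable_const _).add
        (((memLp_id_gaussianReal (μ := 0) (v := 1) 1).integrable le_rfl).abs.const_mul 12)).const_mul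
          _)
      (continuous_orbitError ε K).aestronglyMeasurable
      (Filter.Eventually.of_forall fun v => abs_orbitError_le hε.le v K hε2)
  have hWint : 1 / 2 - 48 * (ε * (K : ℝ) ^ 4) ≤ ∫ v, W v ∂(gaussianReal 0 1) := by
    have hq : Integrable (fun v : ℝ => 1 + 2 * v ^ 2) (gaussianReal 0 1) :=
      (integrable_const _).add (integrable_sq_gaussian.const_mul 2)
    have h1 : ∫ v, (freeError K v - 16 * (ε * (K : ℝ) ^ 4) * (1 + 2 * v ^ 2)) ∂(gaussianReal 0 1)
        ≤ ∫ v, W v ∂(gaussianReal 0 1) := by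
      refine integral_mono ((integrable_freeError K).sub (hq.const_mul _)) hWi
        fun v => ?_
      have := (abs_le.1 (abs_orbitError_sub_freeError_le hε.le v K hε2)).1
      simp only [hW]
      linarith
    rw [integral_sub (integrable_freeError K) (hq.const_mul _),
      integral_const_mul, integral_add (integrable_const _) (integrable_sq_gaussian.const_mul 2),
      integral_const_mul, integral_sq_gaussian] at h1
    have := half_le_integral_freeError hK
    simp at h1 this
    linarith
  -- The force vanishes at the starting point, so the boundary term of the energy error is
  -- nonnegative and can be dropped.
  have hpt : ∀ v, Real.exp (-(lineEnergy ε ((lineStep ε)^[K] (0, v)) - lineEnergy ε (0, v))) ≤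
      1 - ε / 64 * W v + (ε * K) ^ 2 * ((2 + 12 * |v|) ^ 2 * Real.exp (1 + |v|)) := by
    intro v
    rw [lineEnergy_iterate_sub]
    have hWv := abs_orbitError_le hε.le v K hε2
    have h1 : Real.exp (-(ε / 64 * W v)) ≤ _ := exp_neg_le (ε / 64 * W v)
    refine le_trans (Real.exp_le_exp.2 ?_) (h1.trans ?_)
    · have : 0 ≤ ε ^ 2 / 8 * cosForce ((lineStep ε)^[K] (0, v)).1 ^ 2 := by positivity
      simp only [cosForce_zero, hW, orbitError]
      linarith
    · have h2 : |ε / 64 * W v| ≤ ε * K * (2 + 12 * |v|) / 64 := by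
        rw [abs_mul, abs_of_pos (by positivity : 0 < ε / 64)]
        calc ε / 64 * |W v| ≤ ε / 64 * (K * (2 + 12 * |v|)) := by gcongr
          _ = _ := by ring
      have h3 : |ε / 64 * W v| ≤ 1 + |v| := by
        refine h2.trans ?_
        have : ε * K * (2 + 12 * |v|) ≤ 1 * (2 + 12 * |v|) := by gcongr
        linarith [abs_nonneg v]
      have h4 : (ε / 64 * W v) ^ 2 ≤ (ε * K) ^ 2 * (2 + 12 * |v|) ^ 2 := by
        rw [← mul_pow, ← sq_abs]
        gcongr
        refine h2.trans ?_
        have : 0 ≤ ε * K * (2 + 12 * |v|) := by positivity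
        linarith
      rw [← mul_assoc]
      gcongr
  have hsub : Integrable (fun v => 1 - ε / 64 * W v) (gaussianReal 0 1) :=
    (integrable_const _).sub (hWi.const_mul _)
  have hgi : Integrable (fun v => 1 - ε / 64 * W v +
      (ε * K) ^ 2 * ((2 + 12 * |v|) ^ 2 * Real.exp (1 + |v|))) (gaussianReal 0 1) :=
    hsub.add (integrable_exp_abs_gaussian.const_mul _)
  have hYi : Integrable (fun v => Real.exp (-(lineEnergy ε ((lineStep ε)^[K] (0, v)) -
      lineEnergy ε (0, v)))) (gaussianReal 0 1) := by
    have hE : Continuous (lineEnergy ε) := by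
      have := continuous_cosPotential
      unfold lineEnergy; fun_prop
    refine hgi.mono' (Real.continuous_exp.comp (Continuous.neg (Continuous.sub
      (hE.comp (continuous_lineStep_iterate ε K))
      (hE.comp (Continuous.prodMk continuous_const continuous_id))))).aestronglyMeasurable
      (Filter.Eventually.of_forall fun v => ?_)
    rw [Real.norm_of_nonneg (Real.exp_pos _).le]
    exact hpt v
  refine ⟨hYi, (integral_mono hYi hgi hpt).trans ?_⟩
  rw [integral_add hsub (integrable_exp_abs_gaussian.const_mul _),
    integral_sub (integrable_const _) (hWi.const_mul _), integral_const_mul, integral_const_mul,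
    ← hM]
  refine le_trans ?_ (Real.add_one_le_exp _)
  have h5 : (ε * K) ^ 2 * M ≤ ε * (ε * (K : ℝ) ^ 4 * M) := by
    have : (K : ℝ) ^ 2 ≤ K ^ 4 := pow_le_pow_right₀ hK1 (by norm_num)
    calc (ε * K) ^ 2 * M = ε * (ε * (K : ℝ) ^ 2 * M) := by ring
      _ ≤ _ := by gcongr
  have h6 : ε / 64 * (1 / 2 - 48 * (ε * (K : ℝ) ^ 4)) ≤
      ε / 64 * ∫ v, W v ∂(gaussianReal 0 1) := by gcongr
  simp only [integral_const, probReal_univ, smul_eq_mul, mul_one]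
  have h7 : ε * (ε * (K : ℝ) ^ 4 * (192 + 256 * M)) ≤ ε * 1 := by
    gcongr
    have : 0 ≤ ε * (K : ℝ) ^ 4 := by positivity
    linarith
  linarith

/-! ### Dirichlet forms and test functions. -/

section General

variable {Ω : Type*} [MeasurableSpace Ω]

lemma le_relaxationTime {T : Ω → Measure Ω} {π : Measure Ω} {g : Ω → ℝ} {t : ℝ}
    (hg : MemLp g 2 π) (hv : 0 < variance g π) (ht : 0 < t)
    (h : t * dirichletForm T π g g ≤ variance g π) :
    ENNReal.ofReal t ≤ relaxationTime T π := by
  have h1 : spectralGap T π ≤ ENNReal.ofReal t⁻¹ := by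
    refine (iInf₂_le_of_le (f := fun g _ => ⨅ (_ : 0 < variance g π),
      ENNReal.ofReal (dirichletForm T π g g / variance g π)) g hg (iInf_le _ hv)).trans
      (ENNReal.ofReal_le_ofReal ?_)
    rw [div_le_iff₀ hv, inv_mul_eq_div, le_div_iff₀ ht, mul_comm]
    exact h
  rw [ENNReal.ofReal_inv_of_pos ht] at h1
  exact ENNReal.le_inv_iff_le_inv.1 h1

end General

variable {d : ℕ} {f : Space d → ℝ} {η : ℝ} {K : ℕ}

lemma continuous_leapfrog (hf : Continuous (gradient f)) : Continuous (leapfrog f η K) := by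
  refine Continuous.iterate ?_ K
  unfold leapfrogStep
  fun_prop

lemma continuous_acceptProb (hf : Continuous f) (hf' : Continuous (gradient f)) :
    Continuous fun p : Space d × Space d => acceptProb f η K p.1 p.2 := by
  have h := continuous_leapfrog (η := η) (K := K) hf'
  have hH : Continuous (hamiltonian f) := by unfold hamiltonian; fun_prop
  unfold acceptProb
  simp only [← Real.exp_sub]
  fun_prop

lemma continuous_acceptProb_right (hf : Continuous f) (hf' : Continuous (gradient f))
    (x : Space d) : Continuous fun v => acceptProb f η K x v :=
  (continuous_acceptProb hf hf').comp (by fun_prop : Continuous fun v => (x, v))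

lemma acceptProb_nonneg (x v : Space d) : 0 ≤ acceptProb f η K x v :=
  le_min zero_le_one (by positivity)

lemma acceptProb_le_one (x v : Space d) : acceptProb f η K x v ≤ 1 := min_le_left _ _

lemma acceptProb_eq (x v : Space d) : acceptProb f η K x v =
    min 1 (Real.exp (-(hamiltonian f (leapfrog f η K (x, v)) - hamiltonian f (x, v)))) := by
  rw [acceptProb, ← Real.exp_sub]; congr 2; ring

lemma integrable_acceptProb (hf : Continuous f) (hf' : Continuous (gradient f)) (x : Space d) :
    Integrable (fun v => acceptProb f η K x v) (stdGaussian (Space d)) := by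
  refine Integrable.of_bound (C := 1) ?_ (Filter.Eventually.of_forall fun v => ?_)
  · exact (continuous_acceptProb_right hf hf' x).aestronglyMeasurable
  · rw [Real.norm_of_nonneg (acceptProb_nonneg _ _)]; exact acceptProb_le_one _ _

/-- The rejection atom carries exactly the mass missing from the accepted moves, so only accepted
moves change the mean of `g`. -/
lemma integral_transition (hf : Continuous f) (hf' : Continuous (gradient f)) {g : Space d → ℝ}
    (hg : Measurable g) (x : Space d)
    (hint : Integrable (fun v => g (leapfrog f η K (x, v)).1) (stdGaussian (Space d))) :
    ∫ y, g y ∂(transition f η K x) =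
      g x - ∫ v, acceptProb f η K x v * (g x - g (leapfrog f η K (x, v)).1)
        ∂(stdGaussian (Space d)) := by
  have hα : Measurable fun v => acceptProb f η K x v :=
    (continuous_acceptProb_right hf hf' x).measurable
  have hφ : Measurable fun v => (leapfrog f η K (x, v)).1 :=
    (continuous_fst.comp ((continuous_leapfrog hf').comp
      (by fun_prop : Continuous fun v => (x, v)))).measurable
  have hαi := integrable_acceptProb (η := η) (K := K) hf hf' x
  have hle : (stdGaussian (Space d)).withDensity (fun v => ENNReal.ofReal (acceptProb f η K x v)) ≤
      stdGaussian (Space d) := by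
    conv_rhs => rw [← withDensity_one (μ := stdGaussian (Space d))]
    exact withDensity_mono (Filter.Eventually.of_forall fun v =>
      ENNReal.ofReal_le_one.2 (acceptProb_le_one _ _))
  have hmass : ∫⁻ v, ENNReal.ofReal (1 - acceptProb f η K x v) ∂(stdGaussian (Space d)) =
      ENNReal.ofReal (∫ v, (1 - acceptProb f η K x v) ∂(stdGaussian (Space d))) :=
    (ofReal_integral_eq_lintegral_ofReal ((integrable_const _).sub hαi)
      (Filter.Eventually.of_forall fun v => sub_nonneg.2 (acceptProb_le_one _ _))).symm
  have hαg : Integrable (fun v => acceptProb f η K x v * g (leapfrog f η K (x, v)).1)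
      (stdGaussian (Space d)) :=
    hint.bdd_mul (c := 1) hα.aestronglyMeasurable (Filter.Eventually.of_forall fun v => by
      rw [Real.norm_of_nonneg (acceptProb_nonneg _ _)]; exact acceptProb_le_one _ _)
  rw [transition, integral_add_measure]
  · rw [integral_map hφ.aemeasurable hg.aestronglyMeasurable,
      integral_withDensity_eq_integral_toReal_smul (by fun_prop)
        (Filter.Eventually.of_forall fun v => ENNReal.ofReal_lt_top),
      integral_smul_measure, integral_dirac, hmass, ENNReal.toReal_ofReal
        (integral_nonneg fun v => sub_nonneg.2 (acceptProb_le_one _ _))]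
    simp only [ENNReal.toReal_ofReal (acceptProb_nonneg _ _), smul_eq_mul, mul_sub]
    rw [integral_sub (hαi.mul_const _) hαg, integral_mul_const,
      integral_sub (integrable_const _) hαi]
    simp
    ring
  · rw [integrable_map_measure hg.aestronglyMeasurable hφ.aemeasurable]
    exact hint.mono_measure hle
  · refine Integrable.smul_measure ?_ (by rw [hmass]; exact ENNReal.ofReal_ne_top)
    exact integrable_dirac (by finiteness)

lemma dirichletForm_transition [IsProbabilityMeasure (target f)] (hf : Continuous f)
    (hf' : Continuous (gradient f)) {g : Space d → ℝ} (hg : Measurable g)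
    (hg2 : Integrable (fun x => g x * g x) (target f))
    (hint : Integrable (fun p : Space d × Space d => g (leapfrog f η K p).1 * g p.1)
      ((target f).prod (stdGaussian (Space d)))) :
    Integrable (fun p : Space d × Space d =>
      acceptProb f η K p.1 p.2 * (g p.1 * g p.1 - g (leapfrog f η K p).1 * g p.1))
        ((target f).prod (stdGaussian (Space d))) ∧
    dirichletForm (transition f η K) (target f) g g =
      ∫ x, ∫ v, acceptProb f η K x v * (g x * g x - g (leapfrog f η K (x, v)).1 * g x)
        ∂(stdGaussian (Space d)) ∂(target f) := by
  have hI : Integrable (fun p : Space d × Space d =>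
      acceptProb f η K p.1 p.2 * (g p.1 * g p.1 - g (leapfrog f η K p).1 * g p.1))
        ((target f).prod (stdGaussian (Space d))) :=
    ((hg2.comp_fst _).sub hint).bdd_mul (c := 1)
      (continuous_acceptProb hf hf').aestronglyMeasurable (Filter.Eventually.of_forall fun v => by
        rw [Real.norm_of_nonneg (acceptProb_nonneg _ _)]; exact acceptProb_le_one _ _)
  refine ⟨hI, ?_⟩
  have hae : ∀ᵐ x ∂(target f), ∫ y, g y * g x ∂(transition f η K x) =
      g x * g x - ∫ v, acceptProb f η K x v * (g x * g x - g (leapfrog f η K (x, v)).1 * g x)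
        ∂(stdGaussian (Space d)) := by
    filter_upwards [hint.prod_right_ae] with x hx
    exact integral_transition hf hf' (hg.mul_const (g x)) x hx
  rw [dirichletForm, integral_congr_ae hae, integral_sub hg2 hI.integral_prod_left]
  ring

/-- A state from which moves are unlikely to be accepted bounds the relaxation time from below. -/
lemma le_relaxationTime_of_integral_acceptProb_lt [IsProbabilityMeasure (target f)]
    (hf : Continuous f) (hf' : Continuous (gradient f)) (x₀ : Space d) {B : ℝ}
    [Nonempty (Fin d)]
    (hB : ∫ v, acceptProb f η K x₀ v ∂(stdGaussian (Space d)) < B) :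
    ENNReal.ofReal (1 / (2 * B)) ≤ relaxationTime (transition f η K) (target f) := by
  set A : Space d → ℝ := fun x => ∫ v, acceptProb f η K x v ∂(stdGaussian (Space d)) with hA
  have hB0 : 0 < B := (integral_nonneg fun v => acceptProb_nonneg _ _).trans_lt hB
  have hAc : Continuous A := by
    refine continuous_of_dominated (bound := fun _ => 1) (fun x => ?_) (fun x => ?_)
      (integrable_const _) ?_
    · exact (integrable_acceptProb hf hf' x).aestronglyMeasurable
    · refine Filter.Eventually.of_forall fun v => ?_
      rw [Real.norm_of_nonneg (acceptProb_nonneg _ _)]; exact acceptProb_le_one _ _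
    · exact Filter.Eventually.of_forall fun v =>
        (continuous_acceptProb hf hf').comp (by fun_prop : Continuous fun x => (x, v))
  have hac : target f ≪ volume := withDensity_absolutelyContinuous _ _
  -- Positivity of the density gives nonempty open sets positive mass, hence the test indicator
  -- positive variance.
  have hac' : volume ≪ target f := withDensity_absolutelyContinuous'
    (by fun_prop) (Filter.Eventually.of_forall fun x => by simp [Real.exp_pos])
  have hx₀ : target f {x₀} = 0 := hac (by simp)
  -- Mass at most `1/2` makes the variance `p - p²` of the indicator at least `p / 2`; its Dirichlet
  -- form is at most `B p`, since leaving the set requires an acceptance.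
  obtain ⟨U, hU, hUo, hU2⟩ : ∃ U ⊇ {x₀}, IsOpen U ∧ target f U < ENNReal.ofReal (1 / 2) :=
    Set.exists_isOpen_lt_of_lt {x₀} _ (by rw [hx₀]; simp)
  set S := U ∩ {x | A x < B} with hS
  have hSo : IsOpen S := hUo.inter (isOpen_lt hAc continuous_const)
  have hSm : MeasurableSet S := hSo.measurableSet
  have hx₀S : x₀ ∈ S := ⟨hU rfl, hB⟩
  set p := (target f).real S with hp
  have hp0 : 0 < p := by
    refine ENNReal.toReal_pos (fun h => ?_) (measure_ne_top _ _)
    exact (hSo.measure_pos volume ⟨x₀, hx₀S⟩).ne' (hac' h)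
  have hp2 : p ≤ 1 / 2 := by
    refine ENNReal.toReal_le_of_le_ofReal (by norm_num) ?_
    exact (measure_mono Set.inter_subset_left).trans hU2.le
  set g : Space d → ℝ := S.indicator 1 with hg
  have hgm : Measurable g := measurable_one.indicator hSm
  have hg2 : ∀ x, g x * g x = g x := fun x => by by_cases h : x ∈ S <;> simp [hg, h]
  have hg0 : ∀ x, 0 ≤ g x := fun x => Set.indicator_nonneg (fun _ _ => zero_le_one) x
  have hg1 : ∀ x, g x ≤ 1 := fun x => Set.indicator_le_self' (fun _ _ => zero_le_one) x
  have hgL : MemLp g 2 (target f) := MemLp.of_bound hgm.aestronglyMeasurable 1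
    (Filter.Eventually.of_forall fun x => by rw [Real.norm_of_nonneg (hg0 x)]; exact hg1 x)
  have hgi : Integrable g (target f) := hgL.integrable (by norm_num)
  have hgint : ∫ x, g x ∂(target f) = p := integral_indicator_one hSm
  have hvar : variance g (target f) = p - p ^ 2 := by
    rw [variance_eq_sub hgL]
    simp only [Pi.pow_apply, pow_two, hg2, hgint]
  have hint : Integrable (fun p : Space d × Space d => g (leapfrog f η K p).1 * g p.1)
      ((target f).prod (stdGaussian (Space d))) := by
    refine Integrable.of_bound (C := 1) ?_ (Filter.Eventually.of_forall fun q => ?_)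
    · exact ((hgm.comp (measurable_fst.comp (continuous_leapfrog hf').measurable)).mul
        (hgm.comp measurable_fst)).aestronglyMeasurable
    · rw [Real.norm_of_nonneg (mul_nonneg (hg0 _) (hg0 _))]
      exact mul_le_one₀ (hg1 _) (hg0 _) (hg1 _)
  obtain ⟨hI, hE⟩ := dirichletForm_transition (η := η) (K := K) hf hf' hgm
    (by simpa only [hg2] using hgi) hint
  have hEle : dirichletForm (transition f η K) (target f) g g ≤ B * p := by
    rw [hE, ← hgint, ← integral_const_mul]
    refine integral_mono_ae hI.integral_prod_left (hgi.const_mul B) ?_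
    filter_upwards [hI.prod_right_ae] with x hx
    have h1 : ∫ v, acceptProb f η K x v * (g x * g x - g (leapfrog f η K (x, v)).1 * g x)
        ∂(stdGaussian (Space d)) ≤ ∫ v, acceptProb f η K x v * g x ∂(stdGaussian (Space d)) := by
      refine integral_mono hx ((integrable_acceptProb hf hf' x).mul_const _) fun v => ?_
      refine mul_le_mul_of_nonneg_left ?_ (acceptProb_nonneg _ _)
      rw [hg2]
      linarith [mul_nonneg (hg0 (leapfrog f η K (x, v)).1) (hg0 x)]
    refine h1.trans ?_
    rw [integral_mul_const]
    by_cases h : x ∈ S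
    · exact mul_le_mul_of_nonneg_right h.2.le (hg0 x)
    · simp [hg, h]
  refine le_relaxationTime hgL (by rw [hvar]; nlinarith) (by positivity) ?_
  rw [hvar]
  calc 1 / (2 * B) * dirichletForm (transition f η K) (target f) g g ≤ 1 / (2 * B) * (B * p) := by
        gcongr
    _ = p / 2 := by field_simp
    _ ≤ _ := by nlinarith

/-! ### Separable potentials. -/

/-- The potential `x ↦ ∑ i, ψ (x i) + C`. -/
noncomputable def separable (d : ℕ) (ψ : ℝ → ℝ) (C : ℝ) (x : Space d) : ℝ := ∑ i, ψ (x i) + C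

section Separable

variable {ψ ψ' ψ'' : ℝ → ℝ}

lemma gradient_separable (hψ : ∀ t, HasDerivAt ψ (ψ' t) t) (C : ℝ) :
    (∀ x, HasGradientAt (separable d ψ C) (WithLp.toLp 2 fun i => ψ' (x i)) x) := by
  intro x
  rw [hasGradientAt_iff_hasFDerivAt]
  have h : HasFDerivAt (separable d ψ C)
      (∑ i, ψ' (x i) • (EuclideanSpace.proj i : Space d →L[ℝ] ℝ)) x := by
    refine (HasFDerivAt.fun_sum fun i _ => ?_).add_const C
    exact (hψ (x i)).comp_hasFDerivAt x (EuclideanSpace.proj i : Space d →L[ℝ] ℝ).hasFDerivAt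
  refine h.congr_fderiv ?_
  ext v
  simp [PiLp.inner_apply, mul_comm]

lemma hessianBetween_separable {μ L : ℝ} (hψ : ∀ t, HasDerivAt ψ (ψ' t) t)
    (hψ' : ∀ t, HasDerivAt ψ' (ψ'' t) t) (hμ : ∀ t, μ ≤ ψ'' t) (hL : ∀ t, ψ'' t ≤ L) (C : ℝ) :
    HessianBetween μ L (separable d ψ C) := by
  have hg := gradient_eq (gradient_separable (d := d) hψ C)
  have hd : ∀ x v : Space d, ∃ D : Space d →L[ℝ] Space d,
      HasFDerivAt (gradient (separable d ψ C)) D x ∧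
        inner ℝ v (D v) = ∑ i, ψ'' (x i) * v i ^ 2 := by
    intro x v
    rw [hg]
    have h1 : HasFDerivAt (fun x : Space d => fun i => ψ' (x i))
        (ContinuousLinearMap.pi fun i => ψ'' (x i) • (EuclideanSpace.proj i : Space d →L[ℝ] ℝ)) x :=
      hasFDerivAt_pi.2 fun i => (hψ' (x i)).comp_hasFDerivAt x
        (EuclideanSpace.proj i : Space d →L[ℝ] ℝ).hasFDerivAt
    refine ⟨_, ((PiLp.continuousLinearEquiv 2 ℝ fun _ : Fin d => ℝ).symm.toContinuousLinearMap
      |>.hasFDerivAt.comp x h1), ?_⟩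
    simp [PiLp.inner_apply]
    exact Finset.sum_congr rfl fun i _ => by ring
  refine ⟨fun x => (gradient_separable hψ C x).differentiableAt, fun x => ?_, fun x v => ?_,
    fun x v => ?_⟩
  · obtain ⟨D, hD, -⟩ := hd x 0
    exact hD.differentiableAt
  · obtain ⟨D, hD, hv⟩ := hd x v
    rw [hD.fderiv, hv, EuclideanSpace.real_norm_sq_eq, Finset.mul_sum]
    exact Finset.sum_le_sum fun i _ => mul_le_mul_of_nonneg_right (hμ _) (sq_nonneg _)
  · obtain ⟨D, hD, hv⟩ := hd x v
    rw [hD.fderiv, hv, EuclideanSpace.real_norm_sq_eq, Finset.mul_sum]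
    exact Finset.sum_le_sum fun i _ => mul_le_mul_of_nonneg_right (hL _) (sq_nonneg _)

lemma integrable_exp_neg_norm_sq {b : ℝ} (hb : 0 < b) :
    Integrable fun x : Space d => Real.exp (-b * ‖x‖ ^ 2) := by
  have h := GaussianFourier.integrable_cexp_neg_mul_sq_norm_add (V := Space d) (b := (b : ℂ))
    (by simpa using hb) 0 0
  refine h.norm.congr (Filter.Eventually.of_forall fun x => ?_)
  simp only [Complex.norm_exp]
  congr 1
  simp [← Complex.ofReal_pow]

/-- Quadratic growth makes the density integrable, and the additive constant is the logarithm of the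
partition function. It affects neither gradients nor energy differences. -/
lemma exists_isProbabilityMeasure_target_separable (hψ : Continuous ψ) {b c : ℝ} (hb : 0 < b)
    (h : ∀ t, b * t ^ 2 - c ≤ ψ t) :
    ∃ C, IsProbabilityMeasure (target (separable d ψ C)) := by
  have hcont : ∀ C, Continuous (separable d ψ C) := fun C => by unfold separable; fun_prop
  have hi : Integrable fun x => Real.exp (-separable d ψ 0 x) := by
    refine ((integrable_exp_neg_norm_sq (d := d) hb).const_mul (Real.exp (d * c))).mono'
      (by have := hcont 0; exact Continuous.aestronglyMeasurable (by fun_prop))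
      (Filter.Eventually.of_forall fun x => ?_)
    rw [Real.norm_of_nonneg (Real.exp_pos _).le, ← Real.exp_add]
    apply Real.exp_le_exp.2
    have := Finset.sum_le_sum fun i (_ : i ∈ Finset.univ) => h (x i)
    rw [Finset.sum_sub_distrib, ← Finset.mul_sum, ← EuclideanSpace.real_norm_sq_eq] at this
    simp at this
    simp only [separable]
    linarith
  set Z := ∫ x, Real.exp (-separable d ψ 0 x) with hZ
  have hZ0 : 0 < Z := integral_exp_pos hi
  refine ⟨Real.log Z, ⟨?_⟩⟩
  have e : ∀ x, Real.exp (-separable d ψ (Real.log Z) x) =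
      Z⁻¹ * Real.exp (-separable d ψ 0 x) := by
    intro x
    rw [← Real.exp_log (inv_pos.2 hZ0), ← Real.exp_add, Real.log_inv]
    congr 1; simp only [separable]; ring
  rw [target, withDensity_apply _ MeasurableSet.univ, Measure.restrict_univ]
  simp_rw [e]
  rw [← ofReal_integral_eq_lintegral_ofReal (hi.const_mul _)
    (Filter.Eventually.of_forall fun x => by positivity), integral_const_mul, ← hZ,
    inv_mul_cancel₀ hZ0.ne', ENNReal.ofReal_one]

end Separable

/-! ### Large steps: the cosine potential in dimension `d`. -/

section CosinePotential

variable {d : ℕ} {η ε : ℝ}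

/-- The potential `ε * cosPotential` at length scale `η`. -/
noncomputable def scaledCos (ε η t : ℝ) : ℝ := ε * cosPotential (t / η)

lemma hasDerivAt_scaledCos (ε η t : ℝ) :
    HasDerivAt (scaledCos ε η) (ε / η * cosForce (t / η)) t := by
  have := ((hasDerivAt_cosPotential (t / η)).comp t ((hasDerivAt_id t).div_const η)).const_mul ε
  exact this.congr_deriv (by ring)

lemma hasDerivAt_scaledCos_deriv (ε η t : ℝ) :
    HasDerivAt (fun t => ε / η * cosForce (t / η))
      (ε / η ^ 2 * (1 / 2 + Real.cos (4 * (t / η)) / 4)) t := by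
  have := ((hasDerivAt_cosForce (t / η)).comp t ((hasDerivAt_id t).div_const η)).const_mul (ε / η)
  exact this.congr_deriv (by ring)

/-- Coordinates decouple, and measuring positions in units of `η` turns the step size into one while
leaving velocities, and so their Gaussian law, unscaled. -/
lemma leapfrog_scaledCos_apply (hη : η ≠ 0) (C : ℝ) (K : ℕ) (x v : Space d) (i : Fin d) :
    (leapfrog (separable d (scaledCos ε η) C) η K (x, v)).1 i =
        η * ((lineStep ε)^[K] (x i / η, v i)).1 ∧
      (leapfrog (separable d (scaledCos ε η) C) η K (x, v)).2 i =
        ((lineStep ε)^[K] (x i / η, v i)).2 := by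
  have hg := gradient_eq (gradient_separable (d := d) (hasDerivAt_scaledCos ε η) C)
  induction K with
  | zero => simp [leapfrog]; field_simp
  | succ K ih =>
    rw [leapfrog] at ih ⊢
    rw [Function.iterate_succ_apply', Function.iterate_succ_apply']
    generalize (leapfrogStep (separable d (scaledCos ε η) C) η)^[K] (x, v) = p at ih ⊢
    generalize (lineStep ε)^[K] (x i / η, v i) = z at ih ⊢
    obtain ⟨y, u⟩ := p
    obtain ⟨q, w⟩ := z
    obtain ⟨h1, h2⟩ := ih
    simp only at h1 h2
    have e1 : y i / η = q := by rw [h1]; field_simp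
    have e2 : (y i + η * (u i - η / 2 * (ε / η * cosForce (y i / η)))) / η =
        q + (w - ε / 2 * cosForce q) := by
      rw [e1, h1, h2]; field_simp
    have e3 : η / 2 * (ε / η * cosForce q) = ε / 2 * cosForce q := by field_simp
    have e4 : η / 2 * (ε / η * cosForce (q + (w - ε / 2 * cosForce q))) =
        ε / 2 * cosForce (q + (w - ε / 2 * cosForce q)) := by field_simp
    simp only [leapfrogStep, lineStep, hg, PiLp.add_apply, PiLp.sub_apply, PiLp.smul_apply,
      smul_eq_mul]
    rw [e2, e1, e3, e4, h1, h2]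
    constructor <;> ring

lemma hamiltonian_leapfrog_scaledCos_sub (hη : η ≠ 0) (C : ℝ) (K : ℕ) (v : Space d) :
    hamiltonian (separable d (scaledCos ε η) C)
        (leapfrog (separable d (scaledCos ε η) C) η K (0, v)) -
      hamiltonian (separable d (scaledCos ε η) C) (0, v) =
      ∑ i, (lineEnergy ε ((lineStep ε)^[K] (0, v i)) - lineEnergy ε (0, v i)) := by
  have h := fun i => leapfrog_scaledCos_apply (ε := ε) hη C K 0 v i
  simp only [PiLp.zero_apply, zero_div] at h
  have e : ∀ q, scaledCos ε η (η * q) = ε * cosPotential q := fun q => by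
    rw [scaledCos, mul_div_cancel_left₀ q hη]
  simp only [hamiltonian, separable, EuclideanSpace.real_norm_sq_eq, (h _).1, (h _).2, e,
    lineEnergy, Finset.sum_sub_distrib, Finset.sum_add_distrib, Finset.sum_div]
  simp [scaledCos]
  ring

lemma integral_prod_stdGaussian (F : ℝ → ℝ) (hF : Measurable F) :
    ∫ v, ∏ i, F (v i) ∂(stdGaussian (Space d)) = (∫ t, F t ∂(gaussianReal 0 1)) ^ d := by
  rw [← map_pi_eq_stdGaussian, integral_map (by fun_prop)
    (Measurable.aestronglyMeasurable (by fun_prop))]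
  simp only [integral_fintype_prod_eq_prod (fun _ : Fin d => F)]
  simp

lemma integrable_prod_stdGaussian (F : ℝ → ℝ) (hF : Measurable F)
    (hi : Integrable F (gaussianReal 0 1)) :
    Integrable (fun v => ∏ i, F (v i)) (stdGaussian (Space d)) := by
  rw [← map_pi_eq_stdGaussian, integrable_map_measure
    (Measurable.aestronglyMeasurable (by fun_prop)) (by fun_prop)]
  exact Integrable.fintype_prod fun _ => hi

/-- For step sizes that are not small, the cosine potential makes HMC mix slowly. -/
lemma exists_slow_potential_of_large_step : ∃ δ : ℝ, 0 < δ ∧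
    ∀ (d : ℕ) (κ μ η : ℝ) (K : ℕ), 0 < d → 0 < κ → μ ≤ κ / 4 → 0 < η → 1 ≤ K →
      κ * η ^ 2 * (K : ℝ) ^ 4 ≤ δ →
      ∃ f : Space d → ℝ, HessianBetween μ κ f ∧ IsProbabilityMeasure (target f) ∧
        ENNReal.ofReal (Real.exp (κ * η ^ 2 * d / 256) / 4) ≤
          relaxationTime (transition f η K) (target f) := by
  obtain ⟨δ, hδ, H⟩ := exists_integral_exp_neg_energy_le
  refine ⟨δ, hδ, fun d κ μ η K hd hκ hμ hη hK hδK => ?_⟩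
  set ε := κ * η ^ 2 with hε
  have hε0 : 0 < ε := by positivity
  obtain ⟨hYi, hY⟩ := H ε K hε0 hK hδK
  have hεη : ε / η ^ 2 = κ := by rw [hε]; field_simp
  have hcos : ∀ t, |Real.cos t| ≤ 1 := Real.abs_cos_le_one
  obtain ⟨C, hC⟩ := exists_isProbabilityMeasure_target_separable (d := d) (ψ := scaledCos ε η)
    (b := κ / 4) (c := ε / 64)
    (continuous_iff_continuousAt.2 fun t => (hasDerivAt_scaledCos ε η t).continuousAt)
    (by positivity) (fun t => by
      have h1 : scaledCos ε η t = κ / 4 * t ^ 2 - ε / 64 * Real.cos (4 * (t / η)) := by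
        rw [scaledCos, cosPotential, ← hεη]; field_simp
      rw [h1]
      have := (abs_le.1 (hcos (4 * (t / η)))).2
      nlinarith)
  have hH : HessianBetween μ κ (separable d (scaledCos ε η) C) := by
    refine hessianBetween_separable (hasDerivAt_scaledCos ε η) (hasDerivAt_scaledCos_deriv ε η)
      (fun t => ?_) (fun t => ?_) C
    all_goals
      rw [hεη]
      have := abs_le.1 (hcos (4 * (t / η)))
      nlinarith
  refine ⟨_, hH, hC, ?_⟩
  have hf := hH.differentiable.continuous
  have hf' := hH.differentiable_gradient.continuous
  have : Nonempty (Fin d) := ⟨⟨0, hd⟩⟩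
  set F : ℝ → ℝ := fun t =>
    Real.exp (-(lineEnergy ε ((lineStep ε)^[K] (0, t)) - lineEnergy ε (0, t))) with hF
  have hFm : Measurable F := by
    have hE : Continuous (lineEnergy ε) := by
      have := continuous_cosPotential
      unfold lineEnergy; fun_prop
    exact (Real.continuous_exp.comp (Continuous.neg (Continuous.sub
      (hE.comp (continuous_lineStep_iterate ε K))
      (hE.comp (Continuous.prodMk continuous_const continuous_id))))).measurable
  -- The factor `2` only makes the inequality strict, so that it persists in a neighbourhood of the
  -- origin.
  have hlt : ∫ v, acceptProb (separable d (scaledCos ε η) C) η K 0 v ∂(stdGaussian (Space d)) <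
      2 * Real.exp (-(ε * d / 256)) := by
    have h1 : ∫ v, acceptProb (separable d (scaledCos ε η) C) η K 0 v ∂(stdGaussian (Space d)) ≤
        ∫ v, ∏ i, F (v i) ∂(stdGaussian (Space d)) := by
      refine integral_mono (integrable_acceptProb hf hf' 0)
        (integrable_prod_stdGaussian F hFm hYi) fun v => ?_
      simp only [hF]
      rw [acceptProb_eq, hamiltonian_leapfrog_scaledCos_sub hη.ne', ← Real.exp_sum,
        Finset.sum_neg_distrib]
      exact min_le_right _ _
    rw [integral_prod_stdGaussian F hFm] at h1
    have h2 : (∫ t, F t ∂(gaussianReal 0 1)) ^ d ≤ Real.exp (-(ε / 256)) ^ d :=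
      pow_le_pow_left₀ (integral_nonneg fun t => (Real.exp_pos _).le) hY d
    rw [← Real.exp_nat_mul] at h2
    have h3 : (d : ℝ) * -(ε / 256) = -(ε * d / 256) := by ring
    rw [h3] at h2
    have := Real.exp_pos (-(ε * d / 256))
    linarith
  have h := le_relaxationTime_of_integral_acceptProb_lt hf hf' 0 hlt
  convert h using 2
  rw [Real.exp_neg]
  field_simp
  norm_num

end CosinePotential

/-! ### Small steps: the isotropic Gaussian. -/

section Quadratic

variable {d : ℕ} {μ η : ℝ}

/-- The potential `x ↦ μ ‖x‖² / 2 + C`. -/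
noncomputable def quadratic (d : ℕ) (μ C : ℝ) : Space d → ℝ :=
  separable d (fun t => μ / 2 * t ^ 2) C

lemma quadratic_apply (C : ℝ) (x : Space d) : quadratic d μ C x = μ / 2 * ‖x‖ ^ 2 + C := by
  rw [quadratic, separable, EuclideanSpace.real_norm_sq_eq, Finset.mul_sum]

lemma hasDerivAt_mul_sq (μ t : ℝ) : HasDerivAt (fun t => μ / 2 * t ^ 2) (μ * t) t :=
  ((hasDerivAt_pow 2 t).const_mul (μ / 2)).congr_deriv (by push_cast; ring)

lemma gradient_quadratic (C : ℝ) : gradient (quadratic d μ C) = fun x => μ • x := by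
  rw [quadratic, gradient_eq (gradient_separable (hasDerivAt_mul_sq μ) C)]
  ext x i
  simp

lemma hessianBetween_quadratic {L : ℝ} (h : μ ≤ L) (C : ℝ) :
    HessianBetween μ L (quadratic d μ C) :=
  hessianBetween_separable (ψ'' := fun _ => μ) (hasDerivAt_mul_sq μ)
    (fun t => by simpa using (hasDerivAt_id t).const_mul μ) (fun _ => le_rfl) (fun _ => h) C

lemma hamiltonian_leapfrogStep_quadratic (C : ℝ) (z : Space d × Space d) :
    hamiltonian (quadratic d μ C) (leapfrogStep (quadratic d μ C) η z) -
      hamiltonian (quadratic d μ C) z =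
      η ^ 2 * μ ^ 2 / 8 * (‖(leapfrogStep (quadratic d μ C) η z).1‖ ^ 2 - ‖z.1‖ ^ 2) := by
  obtain ⟨x, v⟩ := z
  simp only [hamiltonian, leapfrogStep, quadratic_apply, gradient_quadratic]
  simp only [← real_inner_self_eq_norm_sq, inner_add_left, inner_add_right, inner_sub_left,
    inner_sub_right, real_inner_smul_left, real_inner_smul_right, real_inner_comm x v]
  ring

/-- For a linear force the trapezoidal rule is exact, and the telescoping boundary term is the whole
energy error. -/
lemma hamiltonian_leapfrog_quadratic (C : ℝ) (K : ℕ) (z : Space d × Space d) :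
    hamiltonian (quadratic d μ C) (leapfrog (quadratic d μ C) η K z) -
      hamiltonian (quadratic d μ C) z =
      η ^ 2 * μ ^ 2 / 8 * (‖(leapfrog (quadratic d μ C) η K z).1‖ ^ 2 - ‖z.1‖ ^ 2) := by
  induction K with
  | zero => simp [leapfrog]
  | succ K ih =>
    have h := hamiltonian_leapfrogStep_quadratic (μ := μ) (η := η) C
      (leapfrog (quadratic d μ C) η K z)
    have e : leapfrog (quadratic d μ C) η (K + 1) z =
        leapfrogStep (quadratic d μ C) η (leapfrog (quadratic d μ C) η K z) :=
      Function.iterate_succ_apply' _ _ _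
    rw [e]
    linarith

/-- The orbit is a discrete harmonic oscillator run for a short time, so it stays near free motion.
The bounds on `r` and `s` serve to carry the induction. -/
lemma leapfrog_quadratic (hμ : 0 ≤ μ) (hη : 0 ≤ η) (C : ℝ) (K : ℕ)
    (hK : η ^ 2 * μ * (K : ℝ) ^ 2 ≤ 1 / 2) :
    ∃ p b r s : ℝ, (∀ x v : Space d,
      leapfrog (quadratic d μ C) η K (x, v) = (p • x + b • v, r • x + s • v)) ∧
      |p - 1| ≤ η ^ 2 * μ * (K : ℝ) ^ 2 ∧ |r| ≤ 3 / 2 * (η * μ * K) ∧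
      |b| ≤ 2 * (η * K) ∧ |s - 1| ≤ η ^ 2 * μ * (K : ℝ) ^ 2 := by
  induction K with
  | zero => exact ⟨1, 0, 0, 1, fun x v => by simp [leapfrog], by simp⟩
  | succ K ih =>
    have hk0 : (0 : ℝ) ≤ K := K.cast_nonneg
    have hk1 : (K : ℝ) ≤ K ^ 2 := by
      have : K ≤ K ^ 2 := Nat.le_self_pow two_ne_zero K
      exact_mod_cast this
    push_cast at hK ⊢
    have hθ : 0 ≤ η ^ 2 * μ := by positivity
    have hK' : η ^ 2 * μ * (K : ℝ) ^ 2 ≤ 1 / 2 := le_trans (by gcongr; linarith) hK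
    obtain ⟨p, b, r, s, h, hp, hr, hb, hs⟩ := ih hK'
    refine ⟨p + η * (r - η / 2 * μ * p), b + η * (s - η / 2 * μ * b),
      r - η / 2 * μ * p - η / 2 * μ * (p + η * (r - η / 2 * μ * p)),
      s - η / 2 * μ * b - η / 2 * μ * (b + η * (s - η / 2 * μ * b)), fun x v => ?_, ?_⟩
    · have e : leapfrog (quadratic d μ C) η (K + 1) (x, v) =
          leapfrogStep (quadratic d μ C) η (leapfrog (quadratic d μ C) η K (x, v)) :=
        Function.iterate_succ_apply' _ _ _
      rw [e, h]
      simp only [leapfrogStep, gradient_quadratic]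
      ext1 <;> module
    set p' := p + η * (r - η / 2 * μ * p) with hp'
    set b' := b + η * (s - η / 2 * μ * b) with hb'
    have hημ : 0 ≤ η * μ := by positivity
    have p1 := abs_le.1 hp
    have r1 := abs_le.1 hr
    have b1 := abs_le.1 hb
    have s1 := abs_le.1 hs
    have t1 : η ^ 2 * μ * (K : ℝ) ≤ η ^ 2 * μ * (K : ℝ) ^ 2 := by gcongr
    have t2 : η ^ 2 * μ * ((K : ℝ) + 1) ^ 2 =
      η ^ 2 * μ * (K : ℝ) ^ 2 + 2 * (η ^ 2 * μ * K) + η ^ 2 * μ := by ring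
    have hηr : |η * r| ≤ 3 / 2 * (η ^ 2 * μ * K) := by
      rw [abs_mul, abs_of_nonneg hη]
      calc η * |r| ≤ η * (3 / 2 * (η * μ * K)) := by gcongr
        _ = _ := by ring
    have pa : |p| ≤ 3 / 2 := abs_le.2 ⟨by linarith, by linarith⟩
    have hθp : |η ^ 2 * μ * p| ≤ 3 / 2 * (η ^ 2 * μ) := by
      rw [abs_mul, abs_of_nonneg hθ]
      linarith [mul_le_mul_of_nonneg_left pa hθ]
    have t3 := abs_le.1 hηr
    have t4 := abs_le.1 hθp
    have t5 : 0 ≤ η ^ 2 * μ * K := by positivity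
    have hp1 : |p' - 1| ≤ η ^ 2 * μ * ((K : ℝ) + 1) ^ 2 := by
      have e : p' - 1 = (p - 1) + η * r - η ^ 2 * μ * p / 2 := by rw [hp']; ring
      rw [e, abs_le]
      constructor <;> linarith
    have p2 := abs_le.1 hp1
    refine ⟨hp1, ?_, ?_, ?_⟩
    · have pa' : |p + p'| ≤ 3 := abs_le.2 ⟨by linarith, by linarith⟩
      have e : r - η / 2 * μ * p - η / 2 * μ * p' = r - (η * μ) * (p + p') / 2 := by ring
      have t6 : |(η * μ) * (p + p')| ≤ (η * μ) * 3 := by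
        rw [abs_mul, abs_of_nonneg hημ]; gcongr
      have t7 := abs_le.1 t6
      rw [e, abs_le]
      constructor <;> linarith
    · have e : b' = b + η * s - (η ^ 2 * μ) * b / 2 := by rw [hb']; ring
      have u1 : |η * s| ≤ η * (1 + η ^ 2 * μ * (K : ℝ) ^ 2) := by
        rw [abs_mul, abs_of_nonneg hη]
        gcongr
        exact abs_le.2 ⟨by linarith, by linarith⟩
      have u2 : |(η ^ 2 * μ) * b| ≤ (η ^ 2 * μ) * (2 * (η * K)) := by
        rw [abs_mul, abs_of_nonneg hθ]; gcongr
      have u3 : η * (η ^ 2 * μ * (K : ℝ) ^ 2) ≤ η * (1 / 2) := by gcongr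
      have u4 : η * (η ^ 2 * μ * (K : ℝ)) ≤ η * (1 / 2) := by gcongr; linarith
      have u5 := abs_le.1 u1
      have u6 := abs_le.1 u2
      rw [e, abs_le]
      constructor <;> linarith
    · have hb1 : |b'| ≤ 2 * (η * (K + 1)) := by
        have e : b' = b + η * s - (η ^ 2 * μ) * b / 2 := by rw [hb']; ring
        have u1 : |η * s| ≤ η * (1 + η ^ 2 * μ * (K : ℝ) ^ 2) := by
          rw [abs_mul, abs_of_nonneg hη]
          gcongr
          exact abs_le.2 ⟨by linarith, by linarith⟩
        have u2 : |(η ^ 2 * μ) * b| ≤ (η ^ 2 * μ) * (2 * (η * K)) := by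
          rw [abs_mul, abs_of_nonneg hθ]; gcongr
        have u3 : η * (η ^ 2 * μ * (K : ℝ) ^ 2) ≤ η * (1 / 2) := by gcongr
        have u4 : η * (η ^ 2 * μ * (K : ℝ)) ≤ η * (1 / 2) := by gcongr; linarith
        have u5 := abs_le.1 u1
        have u6 := abs_le.1 u2
        rw [e, abs_le]
        constructor <;> linarith
      have e : s - η / 2 * μ * b - η / 2 * μ * b' - 1 = (s - 1) - (η * μ) * (b + b') / 2 := by ring
      have w1 : |(η * μ) * (b + b')| ≤ (η * μ) * (2 * (η * K) + 2 * (η * (K + 1))) := by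
        rw [abs_mul, abs_of_nonneg hημ]
        gcongr
        exact (abs_add_le _ _).trans (add_le_add hb hb1)
      have w2 := abs_le.1 w1
      rw [e, abs_le]
      constructor <;> linarith

/-- The acceptance rule is a 1-Lipschitz function of the energy error. -/
lemma abs_min_one_exp_neg_sub_le (s t : ℝ) :
    |min 1 (Real.exp (-s)) - min 1 (Real.exp (-t))| ≤ |s - t| := by
  wlog h : s ≤ t generalizing s t
  · rw [abs_sub_comm, abs_sub_comm s t]; exact this t s (le_of_not_ge h)
  have h1 : min 1 (Real.exp (-t)) ≤ min 1 (Real.exp (-s)) :=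
    min_le_min le_rfl (Real.exp_le_exp.2 (by linarith))
  rw [abs_of_nonneg (sub_nonneg.2 h1), abs_of_nonpos (by linarith)]
  have h2 : 1 + (s - t) ≤ Real.exp (s - t) := by linarith [Real.add_one_le_exp (s - t)]
  have h3 : Real.exp (s - t) ≤ 1 := Real.exp_le_one_iff.2 (by linarith)
  have h4 : Real.exp (-t) = Real.exp (s - t) * Real.exp (-s) := by
    rw [← Real.exp_add]; congr 1; ring
  have h0 := Real.exp_pos (-s)
  rcases le_total 1 (Real.exp (-s)) with hs | hs
  · rw [min_eq_left hs]
    rcases le_total 1 (Real.exp (-t)) with ht | ht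
    · rw [min_eq_left ht]; linarith
    · rw [min_eq_right ht, h4]
      linarith [le_mul_of_one_le_right (Real.exp_pos (s - t)).le hs]
  · rw [min_eq_right hs, min_eq_right (by rw [h4]; nlinarith), h4]; nlinarith

lemma integral_target {f : Space d → ℝ} (hf : Continuous f) (g : Space d → ℝ) :
    ∫ x, g x ∂(target f) = ∫ x, Real.exp (-f x) * g x := by
  rw [target, integral_withDensity_eq_integral_toReal_smul (by fun_prop)
    (Filter.Eventually.of_forall fun x => ENNReal.ofReal_lt_top)]
  simp only [ENNReal.toReal_ofReal (Real.exp_pos _).le, smul_eq_mul]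

lemma integral_target_comp_isometry {f : Space d → ℝ} (hf : Continuous f)
    (e : Space d ≃ₗᵢ[ℝ] Space d) (he : ∀ x, f (e x) = f x) (g : Space d → ℝ) :
    ∫ x, g (e x) ∂(target f) = ∫ x, g x ∂(target f) := by
  rw [integral_target hf, integral_target hf]
  have := e.measurePreserving.integral_comp e.toMeasurableEquiv.measurableEmbedding
    fun x => Real.exp (-f x) * g x
  simpa only [he] using this

lemma continuous_quadratic (C : ℝ) : Continuous (quadratic d μ C) := by
  have : quadratic d μ C = fun x => μ / 2 * ‖x‖ ^ 2 + C := funext (quadratic_apply C)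
  rw [this]; fun_prop

lemma integrable_norm_sq_target_quadratic (hμ : 0 < μ) (C : ℝ) :
    Integrable (fun x => ‖x‖ ^ 2) (target (quadratic d μ C)) := by
  have hc := continuous_quadratic (d := d) (μ := μ) C
  rw [target, integrable_withDensity_iff_integrable_smul' (by fun_prop)
    (Filter.Eventually.of_forall fun x => ENNReal.ofReal_lt_top)]
  simp only [ENNReal.toReal_ofReal (Real.exp_pos _).le, smul_eq_mul]
  refine ((integrable_exp_neg_norm_sq (d := d) (b := μ / 4) (by positivity)).const_mul
    (Real.exp (-C) * (4 / μ))).mono' (Continuous.aestronglyMeasurable (by fun_prop))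
    (Filter.Eventually.of_forall fun x => ?_)
  rw [Real.norm_of_nonneg (by positivity), quadratic_apply]
  have h1 : μ / 4 * ‖x‖ ^ 2 ≤ Real.exp (μ / 4 * ‖x‖ ^ 2) := by
    linarith [Real.add_one_le_exp (μ / 4 * ‖x‖ ^ 2)]
  have h2 : ‖x‖ ^ 2 ≤ 4 / μ * Real.exp (μ / 4 * ‖x‖ ^ 2) := by
    rw [div_mul_eq_mul_div, le_div_iff₀ hμ]; linarith
  calc Real.exp (-(μ / 2 * ‖x‖ ^ 2 + C)) * ‖x‖ ^ 2
      ≤ Real.exp (-(μ / 2 * ‖x‖ ^ 2 + C)) * (4 / μ * Real.exp (μ / 4 * ‖x‖ ^ 2)) := by gcongr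
    _ = 4 / μ * (Real.exp (-(μ / 2 * ‖x‖ ^ 2 + C)) * Real.exp (μ / 4 * ‖x‖ ^ 2)) := by ring
    _ = 4 / μ * (Real.exp (-C) * Real.exp (-(μ / 4) * ‖x‖ ^ 2)) := by
        rw [← Real.exp_add, ← Real.exp_add]; congr 2; ring
    _ = _ := by ring

lemma integral_inner_sq_stdGaussian (x : Space d) :
    Integrable (fun v => inner ℝ x v ^ 2) (stdGaussian (Space d)) ∧
      ∫ v, inner ℝ x v ^ 2 ∂(stdGaussian (Space d)) = ‖x‖ ^ 2 := by
  have hL : MemLp (innerSL ℝ x) 2 (stdGaussian (Space d)) := IsGaussian.memLp_dual _ _ _ (by simp)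
  refine ⟨hL.integrable_sq, ?_⟩
  have h := variance_dual_stdGaussian (innerSL ℝ x)
  rw [variance_eq_sub hL, integral_strongDual_stdGaussian, innerSL_apply_norm] at h
  simpa using h

lemma integral_apply_sq_stdGaussian (i : Fin d) :
    Integrable (fun v : Space d => v i ^ 2) (stdGaussian (Space d)) ∧
      ∫ v : Space d, v i ^ 2 ∂(stdGaussian (Space d)) = 1 := by
  have h := integral_inner_sq_stdGaussian (EuclideanSpace.single i (1 : ℝ))
  simpa [EuclideanSpace.inner_single_left] using h

/-- By the symmetry of the velocity, it is nearly uncorrelated with the acceptance. -/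
lemma abs_integral_acceptProb_mul_le {C p b : ℝ} {K : ℕ} (x : Space d) (i : Fin d)
    (h : ∀ v : Space d, (leapfrog (quadratic d μ C) η K (x, v)).1 = p • x + b • v) :
    |∫ v, acceptProb (quadratic d μ C) η K x v * v i ∂(stdGaussian (Space d))| ≤
      η ^ 2 * μ ^ 2 * |p * b| / 4 * ‖x‖ := by
  set α : Space d → ℝ := fun v => acceptProb (quadratic d μ C) η K x v with hα
  set c := η ^ 2 * μ ^ 2 * |p * b| / 2 with hc
  have hc0 : 0 ≤ c := by positivity
  have hlip : ∀ v, |α v - α (-v)| ≤ c * |inner ℝ x v| := by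
    intro v
    have hd : (hamiltonian (quadratic d μ C) (leapfrog (quadratic d μ C) η K (x, v)) -
        hamiltonian (quadratic d μ C) (x, v)) -
        (hamiltonian (quadratic d μ C) (leapfrog (quadratic d μ C) η K (x, -v)) -
        hamiltonian (quadratic d μ C) (x, -v)) =
        η ^ 2 * μ ^ 2 / 2 * (p * b) * inner ℝ x v := by
      rw [hamiltonian_leapfrog_quadratic, hamiltonian_leapfrog_quadratic, h, h, smul_neg,
        ← sub_eq_add_neg, norm_add_sq_real, norm_sub_sq_real, real_inner_smul_left,
        real_inner_smul_right]
      ring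
    simp only [hα, acceptProb_eq]
    refine (abs_min_one_exp_neg_sub_le _ _).trans ?_
    rw [hd, abs_mul, abs_mul, abs_of_nonneg (by positivity : 0 ≤ η ^ 2 * μ ^ 2 / 2), hc]
    apply le_of_eq; ring
  have hf' : Continuous (gradient (quadratic d μ C)) := by
    rw [gradient_quadratic]; fun_prop
  have hαc : Continuous α := continuous_acceptProb_right (continuous_quadratic C) hf' x
  have hαn : Continuous fun v => α (-v) := by fun_prop
  have hα1 : ∀ v, ‖α v‖ ≤ 1 := fun v => by
    rw [Real.norm_of_nonneg (acceptProb_nonneg _ _)]; exact acceptProb_le_one _ _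
  obtain ⟨hi2, hi1⟩ := integral_apply_sq_stdGaussian i
  obtain ⟨hx2, hx1⟩ := integral_inner_sq_stdGaussian x
  have hvi : Integrable (fun v : Space d => v i) (stdGaussian (Space d)) :=
    ((memLp_two_iff_integrable_sq (by fun_prop)).2 hi2).integrable (by norm_num)
  have hαv : Integrable (fun v : Space d => α v * v i) (stdGaussian (Space d)) :=
    hvi.bdd_mul (c := 1) hαc.aestronglyMeasurable (Filter.Eventually.of_forall hα1)
  have hαv' : Integrable (fun v : Space d => α (-v) * v i) (stdGaussian (Space d)) :=
    hvi.bdd_mul (c := 1) hαn.aestronglyMeasurable (Filter.Eventually.of_forall fun v => hα1 (-v))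
  have hneg : ∫ v : Space d, α (-v) * v i ∂(stdGaussian (Space d)) =
      -∫ v : Space d, α v * v i ∂(stdGaussian (Space d)) := by
    have hm := stdGaussian_map (LinearIsometryEquiv.neg ℝ (E := Space d))
    conv_rhs => rw [← hm]
    rw [integral_map (by fun_prop) (Continuous.aestronglyMeasurable (by fun_prop)),
      ← integral_neg]
    congr 1 with v
    simp
  have h2 : 2 * ∫ v : Space d, α v * v i ∂(stdGaussian (Space d)) =
      ∫ v : Space d, (α v - α (-v)) * v i ∂(stdGaussian (Space d)) := by
    simp only [sub_mul]
    rw [integral_sub hαv hαv', hneg]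
    ring
  -- The weighted mean inequality below divides by the norm of `x`; at the origin acceptance is even
  -- in the velocity.
  rcases eq_or_ne x 0 with rfl | hx
  · have h0 : ∫ v : Space d, (α v - α (-v)) * v i ∂(stdGaussian (Space d)) = 0 := by
      have : ∀ v, α v - α (-v) = 0 := fun v => by simpa using hlip v
      simp [this]
    rw [h0] at h2
    have h3 : ∫ v : Space d, α v * v i ∂(stdGaussian (Space d)) = 0 := by linarith
    rw [h3, norm_zero, mul_zero, abs_zero]
  have hn : 0 < ‖x‖ := norm_pos_iff.2 hx
  have hbound : |∫ v : Space d, (α v - α (-v)) * v i ∂(stdGaussian (Space d))| ≤ c * ‖x‖ := by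
    have hgi : Integrable (fun v : Space d => c * (inner ℝ x v ^ 2 / (2 * ‖x‖) +
        ‖x‖ / 2 * v i ^ 2)) (stdGaussian (Space d)) :=
      ((hx2.div_const _).add (hi2.const_mul _)).const_mul c
    rw [← Real.norm_eq_abs]
    refine (norm_integral_le_of_norm_le hgi (Filter.Eventually.of_forall fun v => ?_)).trans ?_
    · rw [Real.norm_eq_abs, abs_mul]
      calc |α v - α (-v)| * |v i| ≤ c * |inner ℝ x v| * |v i| := by gcongr; exact hlip v
        _ = c * (|inner ℝ x v| * |v i|) := by ring
        _ ≤ _ := by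
          gcongr
          rw [← sq_abs (inner ℝ x v), ← sq_abs (v i), div_add' _ _ _ (by positivity),
            le_div_iff₀ (by positivity)]
          nlinarith [sq_nonneg (|inner ℝ x v| - ‖x‖ * |v i|)]
    · rw [integral_const_mul, integral_add (hx2.div_const _) (hi2.const_mul _), integral_div,
        integral_const_mul, hx1, hi1]
      apply le_of_eq; field_simp; ring
  rw [← h2, abs_mul, abs_of_pos (by norm_num : (0:ℝ) < 2)] at hbound
  rw [hc] at hbound
  linarith

/-- For small step sizes, HMC mixes slowly on a Gaussian. -/
lemma exists_slow_potential_of_small_step {κ : ℝ} {K : ℕ} (hd : 0 < d) (hμ : 0 < μ)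
    (hμκ : μ ≤ κ) (hη : 0 < η) (hK : 1 ≤ K) (hθ : η ^ 2 * μ * (K : ℝ) ^ 2 ≤ 1 / 2)
    (hθd : η ^ 2 * μ * Real.sqrt d ≤ 1) :
    ∃ f : Space d → ℝ, HessianBetween μ κ f ∧ IsProbabilityMeasure (target f) ∧
      ENNReal.ofReal (1 / (3 * (η ^ 2 * μ * (K : ℝ) ^ 2))) ≤
        relaxationTime (transition f η K) (target f) := by
  obtain ⟨C, hC⟩ := exists_isProbabilityMeasure_target_separable (d := d)
    (ψ := fun t => μ / 2 * t ^ 2) (b := μ / 2) (c := 0) (by fun_prop) (by positivity)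
    (fun t => by simp)
  refine ⟨quadratic d μ C, hessianBetween_quadratic hμκ C, hC, ?_⟩
  have : IsProbabilityMeasure (target (quadratic d μ C)) := hC
  have hf := continuous_quadratic (d := d) (μ := μ) C
  have hf' : Continuous (gradient (quadratic d μ C)) := by
    rw [gradient_quadratic]; fun_prop
  obtain ⟨p, b, r, s, h, hp, -, hb, -⟩ := leapfrog_quadratic (d := d) hμ.le hη.le C K hθ
  set π := target (quadratic d μ C) with hπ
  set i : Fin d := ⟨0, hd⟩
  have hK0 : (0 : ℝ) < K := by exact_mod_cast hK
  have hd0 : (0 : ℝ) < d := by exact_mod_cast hd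
  have hn := integrable_norm_sq_target_quadratic (d := d) hμ C
  have hLp : ∀ j : Fin d, MemLp (fun x : Space d => x j) 2 π := fun j => by
    rw [memLp_two_iff_integrable_sq (by fun_prop)]
    refine hn.mono' (by fun_prop) (Filter.Eventually.of_forall fun x => ?_)
    rw [Real.norm_of_nonneg (sq_nonneg _), ← sq_abs (x j)]
    gcongr
    exact PiLp.norm_apply_le x j
  have hsq : ∀ j : Fin d, Integrable (fun x : Space d => x j ^ 2) π :=
    fun j => (hLp j).integrable_sq
  set V := ∫ x, x i ^ 2 ∂π with hV
  have hV0 : 0 < V := by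
    have hac : volume ≪ π := withDensity_absolutelyContinuous' (by fun_prop)
      (Filter.Eventually.of_forall fun x => by simp [Real.exp_pos])
    have : π.IsOpenPosMeasure := hac.isOpenPosMeasure
    refine integral_pos_of_integrable_nonneg_nonzero (x := EuclideanSpace.single i 1)
      (by fun_prop) (hsq i) (fun x => sq_nonneg _) (by simp)
  have hmean : ∫ x, x i ∂π = 0 := by
    have := integral_target_comp_isometry hf (LinearIsometryEquiv.neg ℝ)
      (fun x => by simp [quadratic_apply]) (fun x => x i)
    simp only [LinearIsometryEquiv.coe_neg, PiLp.neg_apply, integral_neg] at this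
    linarith
  have hnorm : ∫ x, ‖x‖ ^ 2 ∂π = d * V := by
    simp only [EuclideanSpace.real_norm_sq_eq]
    rw [integral_finsetSum _ fun j _ => hsq j]
    -- Coordinate swaps preserve the target, so the explicit value of `V` is never needed.
    have : ∀ j : Fin d, ∫ x, x j ^ 2 ∂π = V := fun j => by
      have := integral_target_comp_isometry hf
        (LinearIsometryEquiv.piLpCongrLeft 2 ℝ ℝ (Equiv.swap i j))
        (fun x => by simp [quadratic_apply]) (fun x => x j ^ 2)
      rw [← this]
      simp [LinearIsometryEquiv.piLpCongrLeft_apply, Equiv.piCongrLeft'_apply, hV, hπ]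
    simp [this]
  have hvar : variance (fun x : Space d => x i) π = V := by
    rw [variance_eq_sub (hLp i), hmean]
    simp [hV]
  have hint : Integrable (fun q : Space d × Space d =>
      (leapfrog (quadratic d μ C) η K q).1 i * q.1 i) (π.prod (stdGaussian (Space d))) := by
    have hvi : Integrable (fun v : Space d => v i) (stdGaussian (Space d)) :=
      ((memLp_two_iff_integrable_sq (by fun_prop)).2
        (integral_apply_sq_stdGaussian i).1).integrable (by norm_num)
    have h1 := ((hsq i).comp_fst (stdGaussian (Space d))).const_mul p
    have h2 := (((hLp i).integrable (by norm_num)).mul_prod hvi).const_mul b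
    refine (h1.add h2).congr (Filter.Eventually.of_forall fun q => ?_)
    obtain ⟨x, v⟩ := q
    simp [h]
    ring
  obtain ⟨hI, hE⟩ := dirichletForm_transition (η := η) (K := K) hf hf'
    (g := fun x => x i) (by fun_prop) (by simpa only [← pow_two] using hsq i) hint
  have hsd : 0 < Real.sqrt d := Real.sqrt_pos.2 hd0
  set θ := η ^ 2 * μ with hθdef
  set c := θ * (K : ℝ) ^ 2 with hc
  have hc0 : 0 < c := by positivity
  have hpb : |p - 1| ≤ c := hp
  have hp32 : |p| ≤ 3 / 2 := by
    have := abs_le.1 hpb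
    exact abs_le.2 ⟨by linarith, by linarith⟩
  set D := η ^ 2 * μ ^ 2 * |p * b| / 4 with hD
  -- The `√d` reflects the size of the norm of `x` relative to one coordinate; it is paid for by `θ
  -- √d ≤ 1`.
  have hDb : |b| * D * Real.sqrt d ≤ 3 / 2 * c := by
    have h1 : |b| * D = η ^ 2 * μ ^ 2 / 4 * |p| * |b| ^ 2 := by rw [hD, abs_mul]; ring
    rw [h1]
    calc η ^ 2 * μ ^ 2 / 4 * |p| * |b| ^ 2 * Real.sqrt d
        ≤ η ^ 2 * μ ^ 2 / 4 * (3 / 2) * (2 * (η * K)) ^ 2 * Real.sqrt d := by gcongr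
      _ = 3 / 2 * c * (θ * Real.sqrt d) := by rw [hc, hθdef]; ring
      _ ≤ 3 / 2 * c * 1 := by gcongr
      _ = _ := by ring
  have hbD : 0 ≤ |b| * D := by positivity
  have hEle : dirichletForm (transition (quadratic d μ C) η K) π (fun x => x i) (fun x => x i) ≤
      3 * c * V := by
    have hdom : Integrable (fun x : Space d => c * x i ^ 2 +
        |b| * D * (Real.sqrt d / 2 * x i ^ 2 + ‖x‖ ^ 2 / (2 * Real.sqrt d))) π :=
      ((hsq i).const_mul c).add ((((hsq i).const_mul _).add (hn.div_const _)).const_mul _)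
    rw [hE]
    refine (integral_mono_ae hI.integral_prod_left hdom ?_).trans ?_
    · refine Filter.Eventually.of_forall fun x => ?_
      have hvi : Integrable (fun v : Space d => v i) (stdGaussian (Space d)) :=
        ((memLp_two_iff_integrable_sq (by fun_prop)).2
          (integral_apply_sq_stdGaussian i).1).integrable (by norm_num)
      have hαi := integrable_acceptProb (η := η) (K := K) hf hf' x
      have hαv : Integrable (fun v : Space d => acceptProb (quadratic d μ C) η K x v * v i)
          (stdGaussian (Space d)) :=
        hvi.bdd_mul (c := 1) hαi.aestronglyMeasurable (Filter.Eventually.of_forall fun v => by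
          rw [Real.norm_of_nonneg (acceptProb_nonneg _ _)]; exact acceptProb_le_one _ _)
      have e : ∀ v : Space d, acceptProb (quadratic d μ C) η K x v *
          (x i * x i - (leapfrog (quadratic d μ C) η K (x, v)).1 i * x i) =
          acceptProb (quadratic d μ C) η K x v * ((1 - p) * x i ^ 2) -
            acceptProb (quadratic d μ C) η K x v * v i * (b * x i) := fun v => by
        simp [h]; ring
      simp only [e]
      rw [integral_sub (hαi.mul_const _) (hαv.mul_const _), integral_mul_const,
        integral_mul_const]
      have hA0 : 0 ≤ ∫ v, acceptProb (quadratic d μ C) η K x v ∂(stdGaussian (Space d)) :=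
        integral_nonneg fun v => acceptProb_nonneg _ _
      have hA1 : ∫ v, acceptProb (quadratic d μ C) η K x v ∂(stdGaussian (Space d)) ≤ 1 := by
        have := integral_mono hαi (integrable_const 1) fun v => acceptProb_le_one x v
        simpa using this
      have hcov := abs_integral_acceptProb_mul_le x i fun v => congrArg Prod.fst (h x v)
      set A := ∫ v, acceptProb (quadratic d μ C) η K x v ∂(stdGaussian (Space d))
      set B := ∫ v : Space d, acceptProb (quadratic d μ C) η K x v * v i ∂(stdGaussian (Space d))
      have k1 : A * ((1 - p) * x i ^ 2) ≤ c * x i ^ 2 := by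
        have : 1 - p ≤ c := by linarith [(abs_le.1 hpb).1]
        calc A * ((1 - p) * x i ^ 2) ≤ A * (c * x i ^ 2) := by gcongr
          _ ≤ 1 * (c * x i ^ 2) := by gcongr
          _ = _ := one_mul _
      have k2 : -(B * (b * x i)) ≤ |b| * D * (|x i| * ‖x‖) := by
        calc -(B * (b * x i)) ≤ |B * (b * x i)| := neg_le_abs _
          _ = |B| * (|b| * |x i|) := by rw [abs_mul, abs_mul]
          _ ≤ D * ‖x‖ * (|b| * |x i|) := by gcongr
          _ = _ := by ring
      -- This weight balances the two terms: since the mean of `‖x‖²` is `d V`, each integrates to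
      -- `√d V / 2`.
      have k3 : |x i| * ‖x‖ ≤ Real.sqrt d / 2 * x i ^ 2 + ‖x‖ ^ 2 / (2 * Real.sqrt d) := by
        rw [← sq_abs (x i), add_div' _ _ _ (by positivity), le_div_iff₀ (by positivity)]
        nlinarith [sq_nonneg (Real.sqrt d * |x i| - ‖x‖)]
      have k4 := mul_le_mul_of_nonneg_left k3 hbD
      linarith
    · have hq : Integrable (fun x : Space d =>
          Real.sqrt d / 2 * x i ^ 2 + ‖x‖ ^ 2 / (2 * Real.sqrt d)) π :=
        ((hsq i).const_mul _).add (hn.div_const _)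
      rw [integral_add ((hsq i).const_mul c) (hq.const_mul _), integral_const_mul,
        integral_const_mul, integral_add ((hsq i).const_mul _) (hn.div_const _),
        integral_const_mul, integral_div, hnorm, ← hV]
      have e : (d : ℝ) * V / (2 * Real.sqrt d) = Real.sqrt d / 2 * V := by
        rw [div_eq_iff (by positivity)]
        linear_combination -V * (Real.mul_self_sqrt hd0.le)
      rw [e]
      nlinarith
  refine le_relaxationTime (hLp i) (by rw [hvar]; exact hV0) (by positivity) ?_
  rw [hvar, one_div, inv_mul_le_iff₀ (by positivity)]
  exact hEle

end Quadratic

/-! ### The two regimes combined. -/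

lemma eventually_log_le_rpow (a : ℝ) (ha : 0 < a) {r : ℝ} (hr : 0 < r) :
    ∀ᶠ d : ℕ in Filter.atTop, Real.log d ≤ a * (d : ℝ) ^ r := by
  have h := (isLittleO_log_rpow_atTop hr).bound ha
  filter_upwards [tendsto_natCast_atTop_atTop.eventually h] with d hd
  rw [Real.norm_eq_abs, Real.norm_of_nonneg (by positivity)] at hd
  exact (le_abs_self _).trans hd

/-- The convexity parameter `μ` is kept free so that `μ = 1 / log d` and `μ = 1` give both parts of
the theorem with the same constants. -/
lemma exists_slow_potential (C₁ C₂ C₃ : ℝ) :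
    ∃ c : ℝ, 0 < c ∧ ∃ d₀ : ℕ, ∀ d : ℕ, d₀ ≤ d → 1 ≤ Real.log d ∧
      ∀ κ μ : ℝ, 10 ≤ κ → κ ≤ C₃ * (d : ℝ) ^ 4 → 1 / Real.log d ≤ μ → μ ≤ 1 →
      ∀ (η : ℝ) (K : ℕ), 0 < η → 1 ≤ K →
        η ^ 2 * (K : ℝ) ≤ C₁ * (Real.sqrt (Real.log d) / (κ * Real.sqrt d)) →
        (K : ℝ) ≤ C₂ * (d : ℝ) ^ (0.099 : ℝ) →
        ∃ f : Space d → ℝ, HessianBetween μ κ f ∧ IsProbabilityMeasure (target f) ∧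
          ENNReal.ofReal (c * (κ * d / ((K : ℝ) ^ 2 * (μ * Real.log d)))) ≤
            relaxationTime (transition f η K) (target f) := by
  obtain ⟨δ, hδ, H⟩ := exists_slow_potential_of_large_step
  set B₁ := |C₁| + 1
  set B₂ := |C₂| + 1
  set B₃ := |C₃| + 1
  have hB₁ : 0 < B₁ := by positivity
  have hB₂ : 0 < B₂ := by positivity
  have hB₃ : 0 < B₃ := by positivity
  have hC₁ : C₁ ≤ B₁ := by linarith [le_abs_self C₁]
  have hC₂ : C₂ ≤ B₂ := by linarith [le_abs_self C₂]
  have hC₃ : C₃ ≤ B₃ := by linarith [le_abs_self C₃]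
  set δ' := min δ (1 / 2)
  have hδ' : 0 < δ' := by positivity
  -- The first bound serves large steps, whose relaxation time is at least `d ^ 5 / 4`; the second
  -- serves small ones, with `3840 = 3 * 1280`.
  refine ⟨min (1 / (4 * B₃)) (1 / 3840), by positivity, ?_⟩
  set c := min (1 / (4 * B₃)) (1 / 3840)
  have hc0 : 0 < c := by positivity
  have hcB : c ≤ 1 / (4 * B₃) := min_le_left _ _
  have hcA : c ≤ 1 / 3840 := min_le_right _ _
  have hlog := (Real.tendsto_log_atTop.comp tendsto_natCast_atTop_atTop).eventually_ge_atTop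
    (1 : ℝ)
  -- The exponent is `0.203 = 1/2 - 3 * 0.099`: `κ η² K` decays like `d ^ (-1/2)` up to logarithms,
  -- and `K³` grows at most like `d ^ 0.297`.
  obtain ⟨d₀, hd₀⟩ := Filter.eventually_atTop.1 (hlog.and
    ((eventually_log_le_rpow (δ' / (B₁ * B₂ ^ 3)) (by positivity)
      (by norm_num : (0:ℝ) < 0.203)).and
    ((eventually_log_le_rpow (1 / 1280) (by norm_num) (by norm_num : (0:ℝ) < 1 / 2)).and
      (Filter.eventually_ge_atTop 1))))
  refine ⟨d₀, fun d hd => ?_⟩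
  obtain ⟨h1, h2, h3, h4⟩ := hd₀ d hd
  simp only [Function.comp_apply] at h1
  refine ⟨h1, fun κ μ hκ hκC hμ hμ1 η K hη hK hηK hKd => ?_⟩
  set ℓ := Real.log d with hℓ
  have hℓ0 : 0 < ℓ := by linarith
  have hκ0 : 0 < κ := by linarith
  have hd0 : (0 : ℝ) < d := by exact_mod_cast h4
  have hK1 : (1 : ℝ) ≤ K := by exact_mod_cast hK
  have hK0 : (0 : ℝ) < K := by linarith
  have hμ0 : 0 < μ := lt_of_lt_of_le (by positivity) hμ
  have hμℓ : 1 ≤ μ * ℓ := by rwa [div_le_iff₀ hℓ0] at hμ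
  have hsd : 0 < Real.sqrt d := Real.sqrt_pos.2 hd0
  have hKd' : (K : ℝ) ≤ B₂ * (d : ℝ) ^ (0.099 : ℝ) := hKd.trans (by gcongr)
  have hmain : κ * η ^ 2 * (K : ℝ) ^ 4 ≤ δ' := by
    have a1 : κ * (η ^ 2 * K) ≤ B₁ * (ℓ / Real.sqrt d) := by
      have hs : Real.sqrt ℓ ≤ ℓ := (Real.sqrt_le_left hℓ0.le).2 (by nlinarith)
      calc κ * (η ^ 2 * K) ≤ κ * (C₁ * (Real.sqrt ℓ / (κ * Real.sqrt d))) := by gcongr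
        _ ≤ κ * (B₁ * (ℓ / (κ * Real.sqrt d))) := by gcongr
        _ = _ := by field_simp
    have a2 : (K : ℝ) ^ 3 ≤ B₂ ^ 3 * (d : ℝ) ^ (0.297 : ℝ) := by
      calc (K : ℝ) ^ 3 ≤ (B₂ * (d : ℝ) ^ (0.099 : ℝ)) ^ 3 := by gcongr
        _ = _ := by
          rw [mul_pow, ← Real.rpow_natCast ((d : ℝ) ^ (0.099 : ℝ)), ← Real.rpow_mul hd0.le]
          norm_num
    calc κ * η ^ 2 * (K : ℝ) ^ 4 = κ * (η ^ 2 * K) * (K : ℝ) ^ 3 := by ring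
      _ ≤ B₁ * (ℓ / Real.sqrt d) * (B₂ ^ 3 * (d : ℝ) ^ (0.297 : ℝ)) := by gcongr
      _ ≤ B₁ * (δ' / (B₁ * B₂ ^ 3) * (d : ℝ) ^ (0.203 : ℝ) / Real.sqrt d) *
          (B₂ ^ 3 * (d : ℝ) ^ (0.297 : ℝ)) := by gcongr
      _ = δ' * ((d : ℝ) ^ (0.203 : ℝ) * (d : ℝ) ^ (0.297 : ℝ) / Real.sqrt d) := by field_simp
      _ = δ' := by
          rw [← Real.rpow_add hd0, Real.sqrt_eq_rpow]
          norm_num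
          rw [div_self (by positivity), mul_one]
  -- Since `1280 = 5 * 256`, beyond the threshold `exp (κ η² d / 256)` is at least `d ^ 5`.
  by_cases hstep : κ * η ^ 2 * d ≤ 1280 * ℓ
  · have hθ : η ^ 2 * μ * (K : ℝ) ^ 2 ≤ 1 / 2 := by
      calc η ^ 2 * μ * (K : ℝ) ^ 2 ≤ η ^ 2 * κ * (K : ℝ) ^ 4 := by
            gcongr
            · linarith
            · norm_num
        _ = κ * η ^ 2 * (K : ℝ) ^ 4 := by ring
        _ ≤ δ' := hmain
        _ ≤ 1 / 2 := min_le_right _ _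
    have hθd : η ^ 2 * μ * Real.sqrt d ≤ 1 := by
      rw [← Real.sqrt_eq_rpow] at h3
      have : η ^ 2 * μ * Real.sqrt d * Real.sqrt d ≤ 1 * Real.sqrt d := by
        rw [mul_assoc, Real.mul_self_sqrt hd0.le]
        calc η ^ 2 * μ * d ≤ η ^ 2 * κ * d := by gcongr; linarith
          _ = κ * η ^ 2 * d := by ring
          _ ≤ 1280 * ℓ := hstep
          _ ≤ 1 * Real.sqrt d := by linarith
      exact le_of_mul_le_mul_right this hsd
    obtain ⟨f, hf, hp, hr⟩ := exists_slow_potential_of_small_step (κ := κ) h4 hμ0 (by linarith) hη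
      hK hθ hθd
    refine ⟨f, hf, hp, le_trans (ENNReal.ofReal_le_ofReal ?_) hr⟩
    calc c * (κ * d / ((K : ℝ) ^ 2 * (μ * ℓ))) ≤ 1 / 3840 * (κ * d / ((K : ℝ) ^ 2 * (μ * ℓ))) := by
          gcongr
      _ = (κ * η ^ 2 * d) / (1280 * ℓ) * (1 / (3 * (η ^ 2 * μ * (K : ℝ) ^ 2))) := by
          field_simp; norm_num
      _ ≤ 1 * (1 / (3 * (η ^ 2 * μ * (K : ℝ) ^ 2))) := by
          gcongr
          rwa [div_le_one (by positivity)]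
      _ = _ := one_mul _
  · obtain ⟨f, hf, hp, hr⟩ := H d κ μ η K h4 hκ0 (by linarith) hη hK
      (hmain.trans (min_le_left _ _))
    refine ⟨f, hf, hp, le_trans (ENNReal.ofReal_le_ofReal ?_) hr⟩
    have hexp : (d : ℝ) ^ 5 ≤ Real.exp (κ * η ^ 2 * d / 256) := by
      rw [← Real.exp_log hd0, ← Real.exp_nat_mul]
      apply Real.exp_le_exp.2
      rw [Real.exp_log hd0, ← hℓ]
      push_cast
      linarith
    have hden : 1 ≤ (K : ℝ) ^ 2 * (μ * ℓ) := one_le_mul_of_one_le_of_one_le (one_le_pow₀ hK1) hμℓ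
    calc c * (κ * d / ((K : ℝ) ^ 2 * (μ * ℓ))) ≤ c * (κ * d / 1) := by gcongr
      _ ≤ 1 / (4 * B₃) * (B₃ * (d : ℝ) ^ 4 * d / 1) := by
          gcongr
          exact hκC.trans (by gcongr)
      _ = (d : ℝ) ^ 5 / 4 := by field_simp
      _ ≤ _ := by gcongr

end HMC

theorem mainTheorem7 (C₁ C₂ C₃ : ℝ) :
    ∃ c : ℝ, 0 < c ∧ ∃ d₀ : ℕ, ∀ d : ℕ, d₀ ≤ d →
      ∀ κ : ℝ, 10 ≤ κ → κ ≤ C₃ * (d : ℝ) ^ 4 →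
      ∀ (η : ℝ) (K : ℕ), 0 < η → 1 ≤ K →
        η ^ 2 * (K : ℝ) ≤ C₁ * (Real.sqrt (Real.log d) / (κ * Real.sqrt d)) →
        (K : ℝ) ≤ C₂ * (d : ℝ) ^ (0.099 : ℝ) →
        (∃ f : HMC.Space d → ℝ,
          HMC.HessianBetween (1 / Real.log d) κ f ∧
          MeasureTheory.IsProbabilityMeasure (HMC.target f) ∧
          ENNReal.ofReal (c * (κ * d / (K : ℝ) ^ 2)) ≤
            HMC.relaxationTime (HMC.transition f η K) (HMC.target f)) ∧
        (∃ f : HMC.Space d → ℝ,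
          HMC.HessianBetween 1 κ f ∧
          MeasureTheory.IsProbabilityMeasure (HMC.target f) ∧
          ENNReal.ofReal (c * (κ * d / ((K : ℝ) ^ 2 * Real.log d))) ≤
            HMC.relaxationTime (HMC.transition f η K) (HMC.target f)) := by
  obtain ⟨c, hc, d₀, H⟩ := HMC.exists_slow_potential C₁ C₂ C₃
  refine ⟨c, hc, d₀, fun d hd κ hκ hκC η K hη hK hηK hKd => ?_⟩
  obtain ⟨hlog, H⟩ := H d hd
  have hlog0 : 0 < Real.log d := by linarith
  constructor
  · have h := H κ (1 / Real.log d) hκ hκC le_rfl (by rwa [div_le_one hlog0]) η K hη hK hηK hKd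
    rwa [one_div_mul_cancel hlog0.ne', mul_one] at h
  · have h := H κ 1 hκ hκC (by rwa [div_le_one hlog0]) le_rfl η K hη hK hηK hKd
    rwa [one_mul] at h
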